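/- **Setting.** Let $p\in\mathbb N$, $p\ge 2$, $0<\ell<1$, $\alpha>0$ with $\ell<\alpha p<1/\ell$. Put $t_{-1}:=0$, $t_n:=\sum_{k=0}^n\ell^k$, $L:=\sum_{k\ge 0}\ell^k$. Let $\mathbb T$ be the rooted metric tree with edges $e_{n,k}\cong[t_{n-1},t_n]$ ($n\in\mathbb N_0$, $0\le k<p^n$), where the endpoint $t_n$ of $e_{n,k}$ is identified with the initial points of its children $e_{n+1,pk+j}$, $0\le j<p$; the root $o$ is the initial point of $e_{0,0}$, and $|x|$ is the distance from $x$ to $o$. Functions on $\mathbb T$ are identified with their components $f_{n,k}=f|_{e_{n,k}}$, and $$\|f\|_{L^2(\mathbb T)}^2:=\sum_{n\ge 0}\sum_{k=0}^{p^n-1}\alpha^n\int_{t_{n-1}}^{t_n}|f_{n,k}(t)|^2\,dt .$$ $H^1(\mathbb T)$ is the Hilbert space of $f\in L^2(\mathbb T)$ that are continuous on $\mathbb T$, with $f_{n,k}\in H^1(t_{n-1},t_n)$ for all $(n,k)$ and $f':=(f'_{n,k})\in L^2(\mathbb T)$, with scalar product $\langle f,g\rangle_{L^2(\mathbb T)}+\langle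 f',g'\rangle_{L^2(\mathbb T)}$. $H^1_c(\mathbb T)$ consists of the $f\in H^1(\mathbb T)$ for which there is $N$ with $f_{n,k}\equiv0$ for all $n>N$, and $H^1_0(\mathbb T)$ is its closure in $H^1(\mathbb T)$. Further, $\tilde H^1(\mathbb T):=\{f\in H^1(\mathbb T):f(o)=0\}$ with scalar product $\langle f',g'\rangle_{L^2(\mathbb T)}$, $\tilde H^1_0(\mathbb T):=\tilde H^1(\mathbb T)\cap H^1_0(\mathbb T)$, $\tilde H^1_\Delta(\mathbb T)$ is the orthogonal complement of $\tilde H^1_0(\mathbb T)$ in $\tilde H^1(\mathbb T)$, and $\tilde P_\Delta$ is the orthogonal projector of $\tilde H^1(\mathbb T)$ onto $\tilde H^1_\Delta(\mathbb T)$. **Harmonic basis.** Let $\mathcal Z:=\{\mathrm{rad}\}\cup\{(n,k,s):n\in\mathbb N_0,\ 0\le k<p^n,\ 1\le s\le p-1\}$, $\nu(\mathrm{rad}):=-1$, $\nu(n,k,s):=n$, and $\theta_s:=e^{2\pi i s/p}$. Define $$F_{-1}(t):=\sqrt{1-\tfrac{\ell}{\alpha p}}\Big(\tfrac{t-t_{n-1}}{(\alpha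 p)^n}+\sum_{k=0}^{n-1}\big(\tfrac{\ell}{\alpha p}\big)^k\Big),\qquad t\in(t_{n-1},t_n),\ n\in\mathbb N_0,$$ and, for $n\in\mathbb N_0$, $$F_n(t):=p^n\Big(\tfrac{\alpha}{\ell}\Big)^{n/2}\sqrt{\tfrac{\alpha p-\ell}{\ell}}\Big(\tfrac{t-t_{n+m-1}}{(\alpha p)^{n+m}}+\sum_{k=1}^{m-1}\big(\tfrac{\ell}{\alpha p}\big)^{n+k}\Big),\qquad t\in(t_{n+m-1},t_{n+m}),\ m\ge1.$$ Set $\phi_{\mathrm{rad}}(x):=F_{-1}(|x|)$; and let $\phi_{n,k,s}(x):=\theta_s^jF_n(|x|)$ if $x$ lies on $e_{n+1,pk+j}$ or on one of its descendants, for some $j\in\{0,\dots,p-1\}$, and $\phi_{n,k,s}(x):=0$ otherwise. Let $\Theta:\ell^2(\mathcal Z)\to\tilde H^1_\Delta(\mathbb T)$, $\Theta a:=\sum_{z\in\mathcal Z}a_z\phi_z$ (convergence in $\tilde H^1(\mathbb T)$), let $F^\infty_m:=\lim_{t\to L^-}F_m(t)$ for $m\ge-1$, and let $(Ma)_z:=p^{-\nu(z)/2}F^\infty_{\nu(z)}a_z$.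 Finally, let $$\sigma:=\frac{1}{2\log p}\log\frac{\alpha p}{\ell}>0,\qquad \ell^2_\sigma(\mathcal Z):=\{a\in\ell^2(\mathcal Z):(p^{\sigma\nu(z)}a_z)\in\ell^2(\mathcal Z)\},\qquad \|a\|_{\ell^2_\sigma(\mathcal Z)}:=\|(p^{\sigma\nu(z)}a_z)\|_{\ell^2(\mathcal Z)}.$$ **Abstract trace operator.** For $\tilde f\in\tilde H^1(\mathbb T)$ set $\tau\tilde f:=M\Theta^{-1}\tilde P_\Delta\tilde f$. For $f\in H^1(\mathbb T)$ set $\tau f:=\tau\tilde f$, where $\tilde f\in\tilde H^1(\mathbb T)$ is any function that coincides with $f$ on all edges of generation $>n$, for some $n\in\mathbb N_0$. **Theorem.** The operator $\tau:H^1(\mathbb T)\to\ell^2_\sigma(\mathcal Z)$ is well defined (for every $f\in H^1(\mathbb T)$ such an $\tilde f$ exists, $\tau\tilde f$ is defined for each such $\tilde f$, belongs to $\ell^2_\sigma(\mathcal Z)$, and does not depend on the choice of $\tilde f$), linear, bounded and surjective, and $\ker\tau=H^1_0(\mathbb T)$. -/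

import Mathlib

open MeasureTheory Set Filter Topology
open scoped ContDiff

noncomputable section

namespace GeomTree

/-! ### The tree -/

/-- `levelStart ℓ n` is `t_{n-1} = ∑_{k<n} ℓ^k`, so that `levelStart ℓ 0 = t_{-1} = 0` and the
edges of generation `n` are copies of `[levelStart ℓ n, levelStart ℓ (n+1)]`. -/
def levelStart (ℓ : ℝ) (n : ℕ) : ℝ := ∑ k ∈ Finset.range n, ℓ ^ k

/-- The height `L = ∑_{k ≥ 0} ℓ^k` of the tree (for `0 < ℓ < 1`). -/
def height (ℓ : ℝ) : ℝ := ∑' k : ℕ, ℓ ^ k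

/-- The edges `e_{n,k}`, `n ∈ ℕ`, `0 ≤ k < p^n`. -/
abbrev Edge (p : ℕ) : Type := Σ n : ℕ, Fin (p ^ n)

/-- The edge `e_{0,0}` issued from the root `o`. -/
def rootEdge (p : ℕ) : Edge p := ⟨0, ⟨0, by simp⟩⟩

/-- `e'` is one of the `p` children of `e`: `e = e_{n,k}` and `e' = e_{n+1,pk+j}`, `0 ≤ j < p`. -/
def IsChild {p : ℕ} (e e' : Edge p) : Prop :=
  e'.1 = e.1 + 1 ∧ ∃ j < p, (e'.2 : ℕ) = p * (e.2 : ℕ) + j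

/-- The measure `α^n dt` on an edge of generation `n`. -/
def edgeMeasure (ℓ α : ℝ) (n : ℕ) : Measure ℝ :=
  ENNReal.ofReal (α ^ n) • volume.restrict (Ioo (levelStart ℓ n) (levelStart ℓ (n + 1)))

/-- `L²` of the tree: square summable families of components
`f_{n,k} ∈ L²((t_{n-1}, t_n), α^n dt)`. -/
abbrev TreeL2 (p : ℕ) (ℓ α : ℝ) : Type :=
  ↥(lp (fun e : Edge p => ↥(Lp ℂ 2 (edgeMeasure ℓ α e.1))) 2)

/-! ### Sobolev spaces on the tree -/

/-- `g` is the weak derivative of `f` on `(a, b)`, for integrable `f` and `g` (all functions in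
`L²` of a bounded interval are integrable). -/
structure IsWeakDeriv (a b : ℝ) (f g : ℝ → ℂ) : Prop where
  integrableOn_fun : IntegrableOn f (Ioo a b)
  integrableOn_deriv : IntegrableOn g (Ioo a b)
  integral_eq : ∀ φ : ℝ → ℝ, ContDiff ℝ ∞ φ → HasCompactSupport φ → tsupport φ ⊆ Ioo a b →
    ∫ t in Ioo a b, deriv φ t • f t = - ∫ t in Ioo a b, φ t • g t

theorem integrable_test_smul {a b : ℝ} {f : ℝ → ℂ} (hf : IntegrableOn f (Ioo a b)) {φ : ℝ → ℝ}
    (hφ : Continuous φ) (hc : HasCompactSupport φ) :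
    IntegrableOn (fun t => φ t • f t) (Ioo a b) := by
  obtain ⟨C, hC⟩ := hφ.bounded_above_of_compact_support hc
  exact Integrable.bdd_smul hf C hφ.aestronglyMeasurable (Eventually.of_forall hC)

theorem IsWeakDeriv.add {a b : ℝ} {f g f' g' : ℝ → ℂ} (h : IsWeakDeriv a b f g)
    (h' : IsWeakDeriv a b f' g') : IsWeakDeriv a b (f + f') (g + g') := by
  refine ⟨h.1.add h'.1, h.2.add h'.2, fun φ h1 h2 h3 => ?_⟩
  have hd : Continuous (deriv φ) := h1.continuous_deriv (by simp)
  simp only [Pi.add_apply, smul_add]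
  rw [integral_add (integrable_test_smul h.1 hd h2.deriv) (integrable_test_smul h'.1 hd h2.deriv),
    integral_add (integrable_test_smul h.2 h1.continuous h2)
      (integrable_test_smul h'.2 h1.continuous h2), h.3 φ h1 h2 h3, h'.3 φ h1 h2 h3, neg_add]

theorem IsWeakDeriv.smul {a b : ℝ} {f g : ℝ → ℂ} (c : ℂ) (h : IsWeakDeriv a b f g) :
    IsWeakDeriv a b (c • f) (c • g) := by
  refine ⟨h.1.smul c, h.2.smul c, fun φ h1 h2 h3 => ?_⟩
  simp only [Pi.smul_apply, smul_comm _ c]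
  rw [integral_smul, integral_smul, h.3 φ h1 h2 h3, smul_neg]

theorem isWeakDeriv_zero (a b : ℝ) : IsWeakDeriv a b 0 0 :=
  ⟨integrableOn_zero, integrableOn_zero, by simp⟩

/-- `F_e` represents `f_e` almost everywhere on every edge `e`. -/
def Represents {p : ℕ} {ℓ α : ℝ} (f : TreeL2 p ℓ α) (F : Edge p → ℝ → ℂ) : Prop :=
  ∀ e, (f e : ℝ → ℂ) =ᵐ[edgeMeasure ℓ α e.1] F e

theorem Represents.add {p : ℕ} {ℓ α : ℝ} {f g : TreeL2 p ℓ α} {F G : Edge p → ℝ → ℂ}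
    (hf : Represents f F) (hg : Represents g G) : Represents (f + g) (F + G) := fun e => by
  have h := Lp.coeFn_add (f e) (g e)
  filter_upwards [h, hf e, hg e] with t h1 h2 h3
  change ((f e + g e : Lp ℂ 2 (edgeMeasure ℓ α e.1)) : ℝ → ℂ) t = F e t + G e t
  rw [h1, Pi.add_apply, h2, h3]

theorem Represents.smul {p : ℕ} {ℓ α : ℝ} {f : TreeL2 p ℓ α} {F : Edge p → ℝ → ℂ} (c : ℂ)
    (hf : Represents f F) : Represents (c • f) (c • F) := fun e => by
  have h := Lp.coeFn_smul c (f e)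
  filter_upwards [h, hf e] with t h1 h2
  change ((c • f e : Lp ℂ 2 (edgeMeasure ℓ α e.1)) : ℝ → ℂ) t = c • F e t
  rw [h1, Pi.smul_apply, h2]

theorem represents_zero (p : ℕ) (ℓ α : ℝ) : Represents (0 : TreeL2 p ℓ α) 0 := fun e =>
  Lp.coeFn_zero ℂ 2 (edgeMeasure ℓ α e.1)

/-- `F = (F_{n,k})` is a continuous function on the tree: each `F_{n,k}` is continuous on the closed
edge, and the values at the common vertex of an edge and its children agree. -/
structure IsContOnTree {p : ℕ} (ℓ : ℝ) (F : Edge p → ℝ → ℂ) : Prop where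
  continuousOn : ∀ e, ContinuousOn (F e) (Icc (levelStart ℓ e.1) (levelStart ℓ (e.1 + 1)))
  vertex : ∀ e e', IsChild e e' → F e (levelStart ℓ (e.1 + 1)) = F e' (levelStart ℓ (e.1 + 1))

theorem IsContOnTree.add {p : ℕ} {ℓ : ℝ} {F G : Edge p → ℝ → ℂ} (hF : IsContOnTree ℓ F)
    (hG : IsContOnTree ℓ G) : IsContOnTree ℓ (F + G) :=
  ⟨fun e => (hF.1 e).add (hG.1 e), fun e e' h => by simp [hF.2 e e' h, hG.2 e e' h]⟩

theorem IsContOnTree.smul {p : ℕ} {ℓ : ℝ} {F : Edge p → ℝ → ℂ} (c : ℂ) (hF : IsContOnTree ℓ F) :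
    IsContOnTree ℓ (c • F) :=
  ⟨fun e => (hF.1 e).const_smul c, fun e e' h => by simp [hF.2 e e' h]⟩

theorem isContOnTree_zero (p : ℕ) (ℓ : ℝ) : IsContOnTree ℓ (0 : Edge p → ℝ → ℂ) :=
  ⟨fun _ => continuousOn_const, fun _ _ _ => rfl⟩

/-- `H¹` of the tree. A function `f` is recorded as the pair `(f, f')` of `f` and its (unique) weak
derivative, so that the inner product inherited from `L² × L²` is
`⟨f, g⟩_{L²} + ⟨f', g'⟩_{L²}`. Such a pair belongs to `H¹` if `f` has a continuous representative
`F` on the tree and each `f'_{n,k}` is the weak derivative of `f_{n,k}` on `(t_{n-1}, t_n)`. -/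
def sobolevH1 (p : ℕ) (ℓ α : ℝ) : Submodule ℂ (WithLp 2 (TreeL2 p ℓ α × TreeL2 p ℓ α)) where
  carrier := {u | ∃ F G : Edge p → ℝ → ℂ, Represents u.fst F ∧ Represents u.snd G ∧
    IsContOnTree ℓ F ∧
    ∀ e, IsWeakDeriv (levelStart ℓ e.1) (levelStart ℓ (e.1 + 1)) (F e) (G e)}
  add_mem' := by
    rintro u v ⟨F, G, h1, h2, h3, h4⟩ ⟨F', G', h1', h2', h3', h4'⟩
    exact ⟨F + F', G + G', h1.add h1', h2.add h2', h3.add h3', fun e => (h4 e).add (h4' e)⟩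
  zero_mem' := ⟨0, 0, represents_zero p ℓ α, represents_zero p ℓ α, isContOnTree_zero p ℓ,
    fun _ => isWeakDeriv_zero _ _⟩
  smul_mem' := by
    rintro c u ⟨F, G, h1, h2, h3, h4⟩
    exact ⟨c • F, c • G, h1.smul c, h2.smul c, h3.smul c, fun e => (h4 e).smul c⟩

/-- The Hilbert space `H¹` of the tree, as a type. -/
abbrev H1 (p : ℕ) (ℓ α : ℝ) : Type := ↥(sobolevH1 p ℓ α)

variable {p : ℕ} {ℓ α : ℝ}

/-- The underlying `L²` function of an element of `H¹`. -/
def H1.fn (u : H1 p ℓ α) : TreeL2 p ℓ α := (u : WithLp 2 (TreeL2 p ℓ α × TreeL2 p ℓ α)).fst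

/-- The derivative `f' ∈ L²` of an element `f` of `H¹`. -/
def H1.der (u : H1 p ℓ α) : TreeL2 p ℓ α := (u : WithLp 2 (TreeL2 p ℓ α × TreeL2 p ℓ α)).snd

/-- `H¹_c`: the elements of `H¹` that vanish on all edges of large generation. -/
def H1c (p : ℕ) (ℓ α : ℝ) : Submodule ℂ (H1 p ℓ α) where
  carrier := {u | ∃ N : ℕ, ∀ e : Edge p, N < e.1 → u.fn e = 0}
  add_mem' := by
    rintro u v ⟨N, hN⟩ ⟨M, hM⟩
    refine ⟨max N M, fun e he => ?_⟩
    change u.fn e + v.fn e = 0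
    rw [hN e (lt_of_le_of_lt (le_max_left _ _) he), hM e (lt_of_le_of_lt (le_max_right _ _) he),
      add_zero]
  zero_mem' := ⟨0, fun _ _ => rfl⟩
  smul_mem' := by
    rintro c u ⟨N, hN⟩
    refine ⟨N, fun e he => ?_⟩
    change c • u.fn e = 0
    rw [hN e he, smul_zero]

/-- `H¹₀`: the closure of `H¹_c` in `H¹`. -/
def H10 (p : ℕ) (ℓ α : ℝ) : Submodule ℂ (H1 p ℓ α) := (H1c p ℓ α).topologicalClosure

/-- `H̃¹`: the elements `f` of `H¹` with `f(o) = 0`. -/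
def H1t (p : ℕ) (ℓ α : ℝ) : Submodule ℂ (H1 p ℓ α) where
  carrier := {u | ∃ F : Edge p → ℝ → ℂ, Represents u.fn F ∧ IsContOnTree ℓ F ∧
    F (rootEdge p) 0 = 0}
  add_mem' := by
    rintro u v ⟨F, h1, h2, h3⟩ ⟨G, h1', h2', h3'⟩
    exact ⟨F + G, h1.add h1', h2.add h2', by simp [h3, h3']⟩
  zero_mem' := ⟨0, represents_zero p ℓ α, isContOnTree_zero p ℓ, rfl⟩
  smul_mem' := by
    rintro c u ⟨F, h1, h2, h3⟩
    exact ⟨c • F, h1.smul c, h2.smul c, by simp [h3]⟩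

/-- `H̃¹₀`: the elements `f` of `H¹₀` with `f(o) = 0`. -/
def H1t0 (p : ℕ) (ℓ α : ℝ) : Submodule ℂ (H1 p ℓ α) := H1t p ℓ α ⊓ H10 p ℓ α

/-- `H̃¹_Δ`: the orthogonal complement of `H̃¹₀` in `H̃¹` with respect to the scalar product
`⟨f', g'⟩_{L²}` of `H̃¹` (the harmonic functions). -/
def H1tDelta (p : ℕ) (ℓ α : ℝ) : Submodule ℂ (H1 p ℓ α) where
  carrier := {u | u ∈ H1t p ℓ α ∧ ∀ v ∈ H1t0 p ℓ α, inner ℂ v.der u.der = 0}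
  add_mem' := by
    rintro u v ⟨h1, h2⟩ ⟨h1', h2'⟩
    refine ⟨add_mem h1 h1', fun w hw => ?_⟩
    change inner ℂ w.der (u.der + v.der) = 0
    rw [inner_add_right, h2 w hw, h2' w hw, add_zero]
  zero_mem' := ⟨zero_mem _, fun w _ => inner_zero_right w.der⟩
  smul_mem' := by
    rintro c u ⟨h1, h2⟩
    refine ⟨Submodule.smul_mem _ c h1, fun w hw => ?_⟩
    change inner ℂ w.der (c • u.der) = 0
    rw [inner_smul_right, h2 w hw, mul_zero]

/-- `h = P̃_Δ g`, for `g ∈ H̃¹`: the orthogonal projection onto `H̃¹_Δ` along `H̃¹₀`. -/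
def IsHarmonicProj (g h : H1 p ℓ α) : Prop := h ∈ H1tDelta p ℓ α ∧ g - h ∈ H1t0 p ℓ α

/-! ### The orthonormal basis of harmonic functions -/

/-- The index set `𝒵 = {rad} ∪ {(n,k,s) : e_{n,k} an edge, 1 ≤ s ≤ p - 1}`. -/
inductive TraceIndex (p : ℕ) : Type
  | rad : TraceIndex p
  | node (e : Edge p) (s : Set.Icc 1 (p - 1)) : TraceIndex p

/-- `ν(rad) = -1` and `ν(n,k,s) = n`. -/
def TraceIndex.nu : TraceIndex p → ℤ
  | .rad => -1
  | .node e _ => e.1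

/-- The generation of the edges containing the points at distance `t` from the root, i.e. the `n`
with `t_{n-1} < t ≤ t_n`. -/
def gen (ℓ t : ℝ) : ℕ := sInf {n : ℕ | t ≤ levelStart ℓ (n + 1)}

/-- The profile `F_rad` on `(0, L)`: for `t ∈ (t_{n-1}, t_n)`,
`F_rad(t) = √(1 - ℓ/(αp)) ((t - t_{n-1})/(αp)^n + ∑_{k=0}^{n-1} (ℓ/(αp))^k)`. -/
def radProfile (p : ℕ) (ℓ α t : ℝ) : ℝ :=
  √(1 - ℓ / (α * p)) *
    ((t - levelStart ℓ (gen ℓ t)) / (α * p) ^ gen ℓ t +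
      ∑ k ∈ Finset.range (gen ℓ t), (ℓ / (α * p)) ^ k)

/-- The profile `F_n` on `(t_n, L)`: for `t ∈ (t_{n+m-1}, t_{n+m})`, `m ≥ 1`,
`F_n(t) = p^n (α/ℓ)^{n/2} √((αp-ℓ)/ℓ) ((t - t_{n+m-1})/(αp)^{n+m} + ∑_{k=1}^{m-1} (ℓ/(αp))^{n+k})`;
here `n + m = gen ℓ t`. -/
def nodeProfile (p : ℕ) (ℓ α : ℝ) (n : ℕ) (t : ℝ) : ℝ :=
  (p : ℝ) ^ n * (α / ℓ) ^ ((n : ℝ) / 2) * √((α * p - ℓ) / ℓ) *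
    ((t - levelStart ℓ (gen ℓ t)) / (α * p) ^ gen ℓ t +
      ∑ i ∈ Finset.Ico (n + 1) (gen ℓ t), (ℓ / (α * p)) ^ i)

/-- The profile `F_{ν(z)}`. -/
def profile (ℓ α : ℝ) : TraceIndex p → ℝ → ℝ
  | .rad => radProfile p ℓ α
  | .node e _ => nodeProfile p ℓ α e.1

/-- The map `U_rad`: `(U_rad F)(x) = F(|x|)`. -/
def liftRad (p : ℕ) (F : ℝ → ℝ) : Edge p → ℝ → ℂ := fun _ t => (F t : ℂ)

/-- The root of unity `θ_s = exp(2πi s / p)`. -/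
def theta (p s : ℕ) : ℂ := Complex.exp (2 * Real.pi * Complex.I / p * s)

/-- The map `U_{n,k,s}`: `(U_{n,k,s} F)(x) = θ_s^j F(|x|)` for `x` in the subtree `𝕋_{n,k}^j`, and
`0` outside of these subtrees. The edges of `𝕋_{n,k}^j` are the `e_{n+m, kp^m + jp^{m-1} + r}` with
`m ≥ 1` and `0 ≤ r < p^{m-1}`; for them `k` is the quotient of the second index by `p^m`, and `j`
is the remainder mod `p` of its quotient by `p^{m-1}`. -/
def liftNode (n k s : ℕ) (F : ℝ → ℝ) : Edge p → ℝ → ℂ := fun e t =>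
  if n < e.1 ∧ (e.2 : ℕ) / p ^ (e.1 - n) = k then
    theta p s ^ (((e.2 : ℕ) / p ^ (e.1 - n - 1)) % p) * (F t : ℂ)
  else 0

/-- The basis function `U_z F_{ν(z)}` on the tree. -/
def basisFun (ℓ α : ℝ) : TraceIndex p → Edge p → ℝ → ℂ
  | .rad => liftRad p (radProfile p ℓ α)
  | .node e s => liftNode e.1 e.2 s (nodeProfile p ℓ α e.1)

/-- `h = Θ a = ∑_z a_z U_z F_{ν(z)}` for `a ∈ ℓ²(𝒵)`: the functions `U_z F_{ν(z)}` are (a.e. equal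
to) elements `φ_z` of `H̃¹`, and the series converges unconditionally to `h` in the norm
`‖f'‖_{L²}` of `H̃¹`. -/
def IsTheta (a : lp (fun _ : TraceIndex p => ℂ) 2) (h : H1 p ℓ α) : Prop :=
  h ∈ H1t p ℓ α ∧ ∃ φ : TraceIndex p → H1 p ℓ α,
    (∀ z, φ z ∈ H1t p ℓ α ∧ Represents (φ z).fn (basisFun ℓ α z)) ∧
    HasSum (fun z => a z • (φ z).der) h.der

/-! ### Weighted sequence spaces and the trace -/

/-- The weight `p^{r ν(z)}`. -/
def weight (r : ℝ) (z : TraceIndex p) : ℝ := (p : ℝ) ^ (r * (z.nu : ℝ))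

/-- The sequences `a ∈ ℓ²(𝒵)` with `(p^{r ν(z)} a_z) ∈ ℓ²(𝒵)`. -/
def weightedSeq (p : ℕ) (r : ℝ) : Submodule ℂ (TraceIndex p → ℂ) where
  carrier := {a | Memℓp a 2 ∧ Memℓp (fun z => (weight r z : ℂ) * a z) 2}
  add_mem' := by
    rintro a b ⟨h1, h2⟩ ⟨h1', h2'⟩
    refine ⟨h1.add h1', ?_⟩
    convert h2.add h2' using 1
    ext z
    simp [mul_add]
  zero_mem' := ⟨zero_memℓp, by simpa using! zero_memℓp⟩
  smul_mem' := by
    rintro c a ⟨h1, h2⟩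
    refine ⟨h1.const_smul c, ?_⟩
    convert h2.const_smul c using 1
    ext z
    simp [mul_left_comm]

/-- The space `ℓ²_r(𝒵)`, with the norm `‖(p^{r ν(z)} a_z)‖_{ℓ²}`. -/
def WeightedL2 (p : ℕ) (r : ℝ) : Type := ↥(weightedSeq p r)

instance (p : ℕ) (r : ℝ) : AddCommGroup (WeightedL2 p r) :=
  inferInstanceAs (AddCommGroup ↥(weightedSeq p r))

instance (p : ℕ) (r : ℝ) : Module ℂ (WeightedL2 p r) :=
  inferInstanceAs (Module ℂ ↥(weightedSeq p r))

/-- The linear map `(a_z) ↦ (p^{r ν(z)} a_z)` from `ℓ²_r(𝒵)` to `ℓ²(𝒵)`. -/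
def WeightedL2.toL2 (p : ℕ) (r : ℝ) : WeightedL2 p r →ₗ[ℂ] lp (fun _ : TraceIndex p => ℂ) 2 where
  toFun a := ⟨fun z => (weight r z : ℂ) * a.1 z, a.2.2⟩
  map_add' a b := by
    ext z
    exact mul_add _ _ _
  map_smul' c a := by
    ext z
    exact mul_left_comm _ _ _

theorem weight_pos [NeZero p] (r : ℝ) (z : TraceIndex p) : 0 < weight r z :=
  Real.rpow_pos_of_pos (by exact_mod_cast Nat.pos_of_ne_zero (NeZero.ne p)) _

theorem WeightedL2.toL2_injective (p : ℕ) [NeZero p] (r : ℝ) :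
    Function.Injective (WeightedL2.toL2 p r) := by
  intro a b h
  apply Subtype.ext
  funext z
  have hz : (weight r z : ℂ) * a.1 z = (weight r z : ℂ) * b.1 z :=
    congrFun (congrArg Subtype.val h) z
  exact mul_left_cancel₀ (by exact_mod_cast (weight_pos r z).ne') hz

instance (p : ℕ) [NeZero p] (r : ℝ) : NormedAddCommGroup (WeightedL2 p r) :=
  NormedAddCommGroup.induced _ _ (WeightedL2.toL2 p r) (WeightedL2.toL2_injective p r)

instance (p : ℕ) [NeZero p] (r : ℝ) : NormedSpace ℂ (WeightedL2 p r) :=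
  NormedSpace.induced ℂ _ _ (WeightedL2.toL2 p r)

/-- `σ = log(αp/ℓ) / (2 log p)`. -/
def sigma (p : ℕ) (ℓ α : ℝ) : ℝ := 1 / (2 * Real.log p) * Real.log (α * p / ℓ)

/-- The limit `F^∞_{ν(z)} = lim_{t → L⁻} F_{ν(z)}(t)`. -/
def profileLimit (ℓ α : ℝ) (z : TraceIndex p) : ℝ :=
  limUnder (𝓝[<] (height ℓ)) (profile ℓ α z)

/-- The coefficient `p^{-ν(z)/2} F^∞_{ν(z)}` of the multiplication operator `M`. -/
def multCoeff (ℓ α : ℝ) (z : TraceIndex p) : ℝ :=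
  (p : ℝ) ^ (-(z.nu : ℝ) / 2) * profileLimit ℓ α z

/-- `a = M Θ⁻¹ P̃_Δ g`, the abstract trace of `g ∈ H̃¹`. -/
def IsTrace (g : H1 p ℓ α) (a : WeightedL2 p (sigma p ℓ α)) : Prop :=
  ∃ (h : H1 p ℓ α) (b : lp (fun _ : TraceIndex p => ℂ) 2),
    IsHarmonicProj g h ∧ IsTheta b h ∧ ∀ z, a.1 z = (multCoeff ℓ α z : ℂ) * b z

/-- `f = g` outside of the truncation `𝕋^n` of the tree after the `n`-th generation, for
some `n`. -/
def EventuallyAgree (f g : H1 p ℓ α) : Prop := ∃ n : ℕ, ∀ e : Edge p, n < e.1 → f.fn e = g.fn e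

end GeomTree

end

noncomputable section

namespace GeomTree

/-! Everything is transported to the derivatives. A function in `H¹` is its value at the root plus
the integral of its derivative along the path from the root (`eq_evalRoot_smul_add`). Since `αpℓ <
1`, a Hardy inequality on the tree makes integration along paths bounded from `L²` to `H¹`
(`exists_hardy`, `exists_poincare`). So `H̃¹` is `L²` of the tree with equivalent norms, and
closures and orthogonal complements may be taken in `L²`.

In `L²`, what is orthogonal to the derivatives of compactly supported functions vanishing at the
root consists of step functions: testing inside one edge gives a constant on each edge, and testing
with a hat function at a vertex gives Kirchhoff's condition (`exists_isKirchhoff_of_orthogonal`).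
Conversely, a square summable Kirchhoff step function is orthogonal to the derivatives of `H̃¹₀` by
Green's formula (`IsKirchhoff.inner_der_eq`).

The derivatives of the `φ_z` are Kirchhoff step functions, square summable because `ℓ < αp`. They
are orthonormal, as different branches carry different characters of `ℤ/p` (`orthonormal_slopeFn`).
They are complete: if all coefficients of a Kirchhoff step function vanish, then by induction on
generations all discrete Fourier coefficients of its values on the children of each edge vanish
(`IsKirchhoff.eq_zero_of_inner_eq_zero`). Hence `Θ⁻¹ P̃_Δ g` is the sequence of coefficients `⟨φ_z',
g'⟩` (`isTrace_iff`), and it vanishes exactly when `g ∈ H̃¹₀`.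

The exponent `σ` is such that `p^{σν(z)}` times the coefficient of `M` is the same for all `z =
(n,k,s)`, so `M` is an isomorphism of `ℓ²` onto `ℓ²_σ` (`exists_multiplier`). For general `f`,
subtracting `f(o)χ`, with `χ` compactly supported and `χ(o) = 1`, gives an admissible `f̃`. Two
admissible choices differ by an element of `H̃¹₀`, on which the trace vanishes. -/

/-! ### Weak derivatives on an interval. -/

theorem intervalIntegrable_of_Ioo {a b : ℝ} {G : ℝ → ℂ} (hG : IntegrableOn G (Ioo a b)) {s t : ℝ}
    (hs : s ∈ Icc a b) (ht : t ∈ Icc a b) : IntervalIntegrable G volume s t := by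
  rw [intervalIntegrable_iff]
  refine IntegrableOn.mono_set ((integrableOn_Icc_iff_integrableOn_Ioo (by simp) (by simp)).2 hG) ?_
  exact uIoc_subset_uIcc.trans (uIcc_subset_Icc hs ht)

theorem continuousOn_primitive_Ioo {a b : ℝ} {G : ℝ → ℂ} (hG : IntegrableOn G (Ioo a b))
    (hab : a ≤ b) : ContinuousOn (fun t => ∫ s in a..t, G s) (Icc a b) := by
  have := intervalIntegral.continuousOn_primitive_interval (f := G) (μ := volume) (a := a) (b := b)
    (by rw [uIcc_of_le hab]; exact (integrableOn_Icc_iff_integrableOn_Ioo (by simp) (by simp)).2 hG)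
  rwa [uIcc_of_le hab] at this

theorem test_apply_right {a b : ℝ} {φ : ℝ → ℝ} (hφ : tsupport φ ⊆ Ioo a b) : φ b = 0 := by
  by_contra h
  exact lt_irrefl b (hφ (subset_tsupport φ h)).2

/-- The density is only integrable, so integration by parts is done by Fubini on the triangle `s ≤
t`: the inner integral of `φ'` over `(s, b)` is `-φ(s)`. -/
theorem isWeakDeriv_primitive {a b : ℝ} {G : ℝ → ℂ} (hab : a ≤ b) (hG : IntegrableOn G (Ioo a b))
    (c : ℂ) : IsWeakDeriv a b (fun t => c + ∫ s in a..t, G s) G := by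
  have hcont : ContinuousOn (fun t => c + ∫ s in a..t, G s) (Icc a b) :=
    continuousOn_const.add (continuousOn_primitive_Ioo hG hab)
  have hint : IntegrableOn (fun t => c + ∫ s in a..t, G s) (Ioo a b) :=
    (hcont.integrableOn_compact isCompact_Icc).mono_set Ioo_subset_Icc_self
  refine ⟨hint, hG, fun φ h1 h2 h3 => ?_⟩
  have hd : Continuous (deriv φ) := h1.continuous_deriv (by simp)
  have hdiff : Differentiable ℝ φ := h1.differentiable (by simp)
  have hsub : ∀ s ∈ Icc a b, ∫ t in s..b, deriv φ t = - φ s := by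
    intro s hs
    rw [intervalIntegral.integral_deriv_eq_sub (fun x _ => hdiff x) (hd.intervalIntegrable _ _),
      test_apply_right h3]
    simp
  have hφa : φ a = 0 := by
    by_contra h
    exact lt_irrefl a (h3 (subset_tsupport φ h)).1
  have hc0 : ∫ t in Ioo a b, deriv φ t • c = 0 := by
    rw [integral_smul_const, ← integral_Ioc_eq_integral_Ioo, ← intervalIntegral.integral_of_le hab,
      hsub a ⟨le_rfl, hab⟩, hφa]
    simp
  have hdi : IntegrableOn (deriv φ) (Ioo a b) := hd.integrableOn_Icc.mono_set Ioo_subset_Icc_self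
  have hprod : Integrable (Function.uncurry fun t s : ℝ => deriv φ t • G s)
      ((volume.restrict (Ioo a b)).prod (volume.restrict (Ioo a b))) := hdi.smul_prod hG
  have hprod2 : Integrable
      (Function.uncurry fun t s : ℝ => if s ≤ t then deriv φ t • G s else 0)
      ((volume.restrict (Ioo a b)).prod (volume.restrict (Ioo a b))) := by
    have hm : MeasurableSet {x : ℝ × ℝ | x.2 ≤ x.1} :=
      measurableSet_le measurable_snd measurable_fst
    refine (hprod.indicator hm).congr (Eventually.of_forall fun x => ?_)
    simp [Function.uncurry, indicator]
  have key : ∫ t in Ioo a b, deriv φ t • ∫ s in a..t, G s = - ∫ s in Ioo a b, φ s • G s := by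
    calc ∫ t in Ioo a b, deriv φ t • ∫ s in a..t, G s
        = ∫ t in Ioo a b, ∫ s in Ioo a b, if s ≤ t then deriv φ t • G s else 0 := by
          refine setIntegral_congr_fun measurableSet_Ioo fun t ht => ?_
          rw [intervalIntegral.integral_of_le ht.1.le, ← integral_smul]
          have h : (fun s => if s ≤ t then deriv φ t • G s else 0) =
              (Iic t).indicator fun s => deriv φ t • G s := by
            ext s; simp [indicator]
          rw [h, setIntegral_indicator measurableSet_Iic]
          congr 2
          ext s
          simp only [mem_Ioc, mem_inter_iff, mem_Ioo, mem_Iic]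
          exact ⟨fun h => ⟨⟨h.1, h.2.trans_lt ht.2⟩, h.2⟩, fun h => ⟨h.1.1, h.2⟩⟩
      _ = ∫ s in Ioo a b, ∫ t in Ioo a b, if s ≤ t then deriv φ t • G s else 0 :=
          integral_integral_swap hprod2
      _ = ∫ s in Ioo a b, - (φ s • G s) := by
          refine setIntegral_congr_fun measurableSet_Ioo fun s hs => ?_
          have h : (fun t => if s ≤ t then deriv φ t • G s else 0) =
              (Ici s).indicator fun t => deriv φ t • G s := by
            ext t; simp [indicator]
          rw [h, setIntegral_indicator measurableSet_Ici]
          have h' : Ioo a b ∩ Ici s = Ico s b := by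
            ext t
            simp only [mem_Ico, mem_inter_iff, mem_Ioo, mem_Ici]
            exact ⟨fun h => ⟨h.2, h.1.2⟩, fun h => ⟨⟨hs.1.trans_le h.1, h.2⟩, h.1⟩⟩
          rw [h', integral_smul_const, integral_Ico_eq_integral_Ioo, ← integral_Ioc_eq_integral_Ioo,
            ← intervalIntegral.integral_of_le hs.2.le, hsub s ⟨hs.1.le, hs.2.le⟩, neg_smul]
      _ = _ := integral_neg _
  have hpi : IntegrableOn (fun t => ∫ s in a..t, G s) (Ioo a b) :=
    ((continuousOn_primitive_Ioo hG hab).integrableOn_compact isCompact_Icc).mono_set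
      Ioo_subset_Icc_self
  simp only [smul_add]
  rw [integral_add (hdi.smul_const c) (integrable_test_smul hpi hd h2.deriv), hc0, zero_add, key]

theorem exists_test_integral_one {a b : ℝ} (hab : a < b) :
    ∃ ρ : ℝ → ℝ, ContDiff ℝ ∞ ρ ∧ HasCompactSupport ρ ∧ tsupport ρ ⊆ Ioo a b ∧
      ∫ t in Ioo a b, ρ t = 1 := by
  let f : ContDiffBump ((a + b) / 2) := ⟨(b - a) / 8, (b - a) / 4, by linarith, by linarith⟩
  have hts : tsupport (f.normed volume) ⊆ Ioo a b := by
    rw [f.tsupport_normed_eq]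
    intro x hx
    rw [Metric.mem_closedBall, Real.dist_eq, abs_le] at hx
    have h1 := hx.1
    have h2 := hx.2
    change -((b - a) / 4) ≤ _ at h1
    change _ ≤ (b - a) / 4 at h2
    exact ⟨by linarith, by linarith⟩
  refine ⟨f.normed volume, f.contDiff_normed, f.hasCompactSupport_normed, hts, ?_⟩
  rw [setIntegral_eq_integral_of_forall_compl_eq_zero, f.integral_normed]
  intro x hx
  by_contra h
  exact hx (hts (subset_tsupport _ h))

/-- A test function of integral zero is the derivative of a test function. -/
theorem exists_test_primitive {a b : ℝ} (hab : a < b) {η : ℝ → ℝ} (h1 : ContDiff ℝ ∞ η)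
    (h2 : HasCompactSupport η) (h3 : tsupport η ⊆ Ioo a b) (h0 : ∫ t in Ioo a b, η t = 0) :
    ∃ φ : ℝ → ℝ, ContDiff ℝ ∞ φ ∧ HasCompactSupport φ ∧ tsupport φ ⊆ Ioo a b ∧ deriv φ = η := by
  have hder : ∀ t, HasDerivAt (fun t => ∫ s in a..t, η s) (η t) t := fun t =>
    intervalIntegral.integral_hasDerivAt_right (h1.continuous.intervalIntegrable _ _)
      (h1.continuous.stronglyMeasurableAtFilter _ _) h1.continuous.continuousAt
  have hd : deriv (fun t => ∫ s in a..t, η s) = η := funext fun t => (hder t).deriv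
  -- The support lies in some `[c, d]` inside `(a, b)`. The primitive vanishes to the left of `c`,
  -- and to the right of `d` because the total integral is zero.
  obtain ⟨c, d, hc, hcd, hd', hsub⟩ : ∃ c d, a < c ∧ c ≤ d ∧ d < b ∧ tsupport η ⊆ Icc c d := by
    rcases (tsupport η).eq_empty_or_nonempty with he | hne
    · exact ⟨(a + b) / 2, (a + b) / 2, by linarith, le_rfl, by linarith, by simp [he]⟩
    · have hcp : IsCompact (tsupport η) := h2
      obtain ⟨x, hx, hx'⟩ := hcp.exists_isLeast hne
      obtain ⟨y, hy, hy'⟩ := hcp.exists_isGreatest hne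
      exact ⟨x, y, (h3 hx).1, hx' hy, (h3 hy).2, fun z hz => ⟨hx' hz, hy' hz⟩⟩
  have hz : ∀ s, s ∉ Icc c d → η s = 0 := fun s hs => by
    by_contra h
    exact hs (hsub (subset_tsupport _ h))
  have hsupp : tsupport (fun t => ∫ s in a..t, η s) ⊆ Icc c d := by
    refine closure_minimal (fun t ht => ?_) isClosed_Icc
    by_contra hn
    apply ht
    rw [mem_Icc, not_and_or, not_le, not_le] at hn
    rcases hn with hn | hn
    · simp only
      rw [intervalIntegral.integral_congr (g := fun _ => (0 : ℝ)), intervalIntegral.integral_zero]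
      intro s hs
      apply hz
      intro hs'
      rcases le_total a t with h | h
      · rw [uIcc_of_le h] at hs
        linarith [hs.2, hs'.1]
      · rw [uIcc_of_ge h] at hs
        linarith [hs.2, hs'.1]
    · simp only
      have hab' : ∫ s in a..b, η s = 0 := by
        rw [intervalIntegral.integral_of_le hab.le, integral_Ioc_eq_integral_Ioo, h0]
      rw [← intervalIntegral.integral_add_adjacent_intervals (b := b)
        (h1.continuous.intervalIntegrable _ _) (h1.continuous.intervalIntegrable _ _), hab',
        zero_add, intervalIntegral.integral_congr (g := fun _ => (0 : ℝ)),
        intervalIntegral.integral_zero]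
      intro s hs
      apply hz
      intro hs'
      rcases le_total b t with h | h
      · rw [uIcc_of_le h] at hs
        linarith [hs.1, hs'.2]
      · rw [uIcc_of_ge h] at hs
        linarith [hs.1, hs'.2]
  refine ⟨_, ?_, ?_, hsupp.trans fun x hx => ⟨hc.trans_le hx.1, hx.2.trans_lt hd'⟩, hd⟩
  · rw [contDiff_infty_iff_deriv, hd]
    exact ⟨fun t => (hder t).differentiableAt, h1⟩
  · exact isCompact_Icc.of_isClosed_subset (isClosed_tsupport _) hsupp

theorem ae_eq_zero_of_forall_test {a b : ℝ} {G : ℝ → ℂ} (hG : IntegrableOn G (Ioo a b))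
    (h : ∀ φ : ℝ → ℝ, ContDiff ℝ ∞ φ → HasCompactSupport φ → tsupport φ ⊆ Ioo a b →
      ∫ t in Ioo a b, φ t • G t = 0) : ∀ᵐ t, t ∈ Ioo a b → G t = 0 := by
  refine isOpen_Ioo.ae_eq_zero_of_integral_contDiff_smul_eq_zero hG.locallyIntegrableOn
    fun φ h1 h2 h3 => ?_
  rw [← h φ h1 h2 h3, setIntegral_eq_integral_of_forall_compl_eq_zero]
  intro t ht
  have : φ t = 0 := by
    by_contra hn
    exact ht (h3 (subset_tsupport _ hn))
  simp [this]

/-- The du Bois-Reymond lemma. -/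
theorem IsWeakDeriv.exists_ae_eq_const {a b : ℝ} (hab : a < b) {f g : ℝ → ℂ}
    (h : IsWeakDeriv a b f g) (hg : ∀ᵐ t, t ∈ Ioo a b → g t = 0) :
    ∃ c, ∀ᵐ t, t ∈ Ioo a b → f t = c := by
  obtain ⟨ρ, r1, r2, r3, r4⟩ := exists_test_integral_one hab
  set c := ∫ t in Ioo a b, ρ t • f t with hc
  have hci : IntegrableOn (fun _ : ℝ => c) (Ioo a b) := integrableOn_const (by simp)
  refine ⟨c, ?_⟩
  have := ae_eq_zero_of_forall_test (a := a) (b := b) (G := fun t => f t - c)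
    (h.integrableOn_fun.sub hci) ?_
  · filter_upwards [this] with t ht ht' using sub_eq_zero.1 (ht ht')
  intro η h1 h2 h3
  set m := ∫ t in Ioo a b, η t with hm
  have hηi : IntegrableOn η (Ioo a b) :=
    h1.continuous.integrableOn_Icc.mono_set Ioo_subset_Icc_self
  have hρi : IntegrableOn ρ (Ioo a b) :=
    r1.continuous.integrableOn_Icc.mono_set Ioo_subset_Icc_self
  -- Subtracting `m ρ` makes the integral zero, so the result is `φ'` for a test function `φ`.
  -- Pairing it with `f` then gives zero, which says that `f - c` is orthogonal to `η`.
  obtain ⟨φ, p1, p2, p3, p4⟩ := exists_test_primitive hab (η := fun t => η t - m * ρ t)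
    (h1.sub (contDiff_const.mul r1)) (h2.sub (r2.mul_left)) (by
      refine closure_minimal (fun t ht => ?_) (isClosed_tsupport η |>.union (isClosed_tsupport ρ))
        |>.trans (union_subset h3 r3)
      by_contra hn
      rw [mem_union, not_or] at hn
      apply ht
      simp [image_eq_zero_of_notMem_tsupport hn.1, image_eq_zero_of_notMem_tsupport hn.2]) (by
      rw [integral_sub hηi (hρi.const_mul m), integral_const_mul, r4, ← hm]
      ring)
  have key := h.integral_eq φ p1 p2 p3
  have hz : ∫ t in Ioo a b, φ t • g t = 0 := by
    rw [setIntegral_congr_ae (g := fun _ => (0 : ℂ)) measurableSet_Ioo, integral_zero]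
    filter_upwards [hg] with t ht ht'
    simp [ht ht']
  rw [hz, neg_zero, p4] at key
  have e1 : ∫ t in Ioo a b, (η t - m * ρ t) • f t =
      (∫ t in Ioo a b, η t • f t) - (m : ℂ) * c := by
    have hm' : IntegrableOn (fun t => m • ρ t • f t) (Ioo a b) :=
      (integrable_test_smul h.integrableOn_fun r1.continuous r2).smul m
    simp only [mul_smul, sub_smul]
    rw [integral_sub (integrable_test_smul h.integrableOn_fun h1.continuous h2) hm', integral_smul]
    simp [hc]
  rw [e1] at key
  simp only [smul_sub]
  rw [integral_sub (integrable_test_smul h.integrableOn_fun h1.continuous h2)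
    (hηi.smul_const c), integral_smul_const, ← hm]
  simpa using key

/-- The difference of `f` and the primitive of `g` has weak derivative zero, hence is constant
almost everywhere, and by continuity everywhere on the closed interval. -/
theorem IsWeakDeriv.eq_primitive {a b : ℝ} (hab : a < b) {f g : ℝ → ℂ} (h : IsWeakDeriv a b f g)
    (hf : ContinuousOn f (Icc a b)) {t : ℝ} (ht : t ∈ Icc a b) :
    f t = f a + ∫ s in a..t, g s := by
  have hp := isWeakDeriv_primitive hab.le h.integrableOn_deriv (f a)
  have hd := h.add (hp.smul (-1))
  obtain ⟨c, hc⟩ := hd.exists_ae_eq_const hab (by simp)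
  have hcont : ContinuousOn (f + (-1 : ℂ) • fun t => f a + ∫ s in a..t, g s) (Icc a b) :=
    hf.add ((continuousOn_const.add
      (continuousOn_primitive_Ioo h.integrableOn_deriv hab.le)).const_smul _)
  have heq := Measure.eqOn_Icc_of_ae_eq volume hab.ne (f := f + (-1 : ℂ) • fun t => f a + ∫ s in a..t, g s)
    (g := fun _ => c) (by
      rw [← restrict_Ioo_eq_restrict_Icc]
      exact (ae_restrict_iff' measurableSet_Ioo).2 hc) hcont continuousOn_const
  have ha := heq ⟨le_rfl, hab.le⟩
  have ht' := heq ht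
  simp at ha ht'
  rw [← ha] at ht'
  linear_combination ht'

theorem IsWeakDeriv.ae_eq_zero {a b : ℝ} {f g : ℝ → ℂ} (h : IsWeakDeriv a b f g)
    (hf : ∀ᵐ t, t ∈ Ioo a b → f t = 0) : ∀ᵐ t, t ∈ Ioo a b → g t = 0 := by
  refine ae_eq_zero_of_forall_test h.integrableOn_deriv fun φ h1 h2 h3 => ?_
  have key := h.integral_eq φ h1 h2 h3
  rw [setIntegral_congr_ae (g := fun _ => (0 : ℂ)) measurableSet_Ioo, integral_zero] at key
  · exact neg_eq_zero.1 key.symm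
  · filter_upwards [hf] with t ht ht'
    simp [ht ht']

/-- The standing assumptions on the parameters of the tree. -/
structure Admissible (p : ℕ) (ℓ α : ℝ) : Prop where
  two_le : 2 ≤ p
  l_pos : 0 < ℓ
  l_lt_one : ℓ < 1
  α_pos : 0 < α
  l_lt : ℓ < α * p
  mul_lt : α * p * ℓ < 1

/-! ### Combinatorics of the tree -/

theorem levelStart_zero (ℓ : ℝ) : levelStart ℓ 0 = 0 := by simp [levelStart]

theorem levelStart_succ (ℓ : ℝ) (n : ℕ) : levelStart ℓ (n + 1) = levelStart ℓ n + ℓ ^ n :=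
  Finset.sum_range_succ _ _

theorem levelStart_lt_succ {ℓ : ℝ} (hℓ : 0 < ℓ) (n : ℕ) :
    levelStart ℓ n < levelStart ℓ (n + 1) := by
  rw [levelStart_succ]
  exact lt_add_of_pos_right _ (pow_pos hℓ n)

theorem levelStart_mem_Icc {ℓ : ℝ} (hℓ : 0 < ℓ) (n : ℕ) :
    levelStart ℓ n ∈ Icc (levelStart ℓ n) (levelStart ℓ (n + 1)) :=
  ⟨le_rfl, (levelStart_lt_succ hℓ n).le⟩

theorem levelStart_succ_mem_Icc {ℓ : ℝ} (hℓ : 0 < ℓ) (n : ℕ) :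
    levelStart ℓ (n + 1) ∈ Icc (levelStart ℓ n) (levelStart ℓ (n + 1)) :=
  ⟨(levelStart_lt_succ hℓ n).le, le_rfl⟩

variable {p : ℕ} {ℓ α : ℝ}

/-- The index of the parent of the edge `e_{n+1,k}`. -/
def parent {n : ℕ} (k : Fin (p ^ (n + 1))) : Fin (p ^ n) :=
  ⟨(k : ℕ) / p, Nat.div_lt_of_lt_mul (by rw [← pow_succ']; exact k.2)⟩

/-- The index of the `j`-th child of the edge `e_{n,k}`. -/
def child {n : ℕ} (k : Fin (p ^ n)) (j : Fin p) : Fin (p ^ (n + 1)) :=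
  Fin.cast (pow_succ p n).symm (finProdFinEquiv (k, j))

theorem child_val {n : ℕ} (k : Fin (p ^ n)) (j : Fin p) : (child k j : ℕ) = p * k + j := by
  simp [child, finProdFinEquiv, add_comm]

@[simp]
theorem parent_child {n : ℕ} (k : Fin (p ^ n)) (j : Fin p) : parent (child k j) = k := by
  apply Fin.ext
  simp only [parent, child_val]
  rw [Nat.mul_add_div j.pos, Nat.div_eq_of_lt j.2, add_zero]

theorem sum_children {E : Type*} [AddCommMonoid E] {n : ℕ} (f : Fin (p ^ (n + 1)) → E) :
    ∑ k, f k = ∑ k, ∑ j, f (child k j) := by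
  rw [← Fintype.sum_prod_type']
  exact (Fintype.sum_equiv (finProdFinEquiv.trans (finCongr (pow_succ p n).symm)) _ _
    fun _ => rfl).symm

theorem exists_child_eq {n : ℕ} (k : Fin (p ^ (n + 1))) : ∃ i j, k = child (p := p) (n := n) i j := by
  obtain ⟨x, hx⟩ := (finProdFinEquiv.trans (finCongr (pow_succ p n).symm)).surjective k
  exact ⟨x.1, x.2, hx.symm⟩

theorem isChild_child {n : ℕ} (k : Fin (p ^ n)) (j : Fin p) :
    IsChild (⟨n, k⟩ : Edge p) ⟨n + 1, child k j⟩ := ⟨rfl, j, j.2, child_val k j⟩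

theorem IsChild.exists_eq {e e' : Edge p} (h : IsChild e e') :
    ∃ j, e' = ⟨e.1 + 1, child e.2 j⟩ := by
  obtain ⟨n, k⟩ := e
  obtain ⟨m, k'⟩ := e'
  obtain ⟨h1, j, hj, h2⟩ := h
  simp only at h1 h2
  subst h1
  refine ⟨⟨j, hj⟩, ?_⟩
  congr 1
  apply Fin.ext
  rw [child_val, h2]

theorem edge_zero_eq (k : Fin (p ^ 0)) : (⟨0, k⟩ : Edge p) = rootEdge p := by
  unfold rootEdge
  congr 1
  apply Fin.ext
  have : (k : ℕ) < 1 := by simpa using k.2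
  simp only
  omega

/-- The sum of the values of `c` at the strict ancestors of an edge. -/
def ancestorSum {E : Type*} [AddCommMonoid E] (c : Edge p → E) : (n : ℕ) → Fin (p ^ n) → E
  | 0, _ => 0
  | n + 1, k => ancestorSum c n (parent k) + c ⟨n, parent k⟩

theorem ancestorSum_child {E : Type*} [AddCommMonoid E] (c : Edge p → E) {n : ℕ} (k : Fin (p ^ n))
    (j : Fin p) : ancestorSum c (n + 1) (child k j) = ancestorSum c n k + c ⟨n, k⟩ := by
  simp [ancestorSum]

theorem ancestorSum_add {E : Type*} [AddCommMonoid E] (c d : Edge p → E) (n : ℕ) (k : Fin (p ^ n)) :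
    ancestorSum (c + d) n k = ancestorSum c n k + ancestorSum d n k := by
  induction n with
  | zero => simp [ancestorSum]
  | succ n ih => simp only [ancestorSum, ih, Pi.add_apply]; exact add_add_add_comm _ _ _ _

theorem ancestorSum_smul {E : Type*} [AddCommMonoid E] [Module ℂ E] (a : ℂ) (c : Edge p → E) (n : ℕ)
    (k : Fin (p ^ n)) : ancestorSum (a • c) n k = a • ancestorSum c n k := by
  induction n with
  | zero => simp [ancestorSum]
  | succ n ih => simp only [ancestorSum, ih, Pi.smul_apply, smul_add]

theorem norm_ancestorSum_le {c : Edge p → ℂ} {m : Edge p → ℝ} (h : ∀ e, ‖c e‖ ≤ m e) (n : ℕ)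
    (k : Fin (p ^ n)) : ‖ancestorSum c n k‖ ≤ ancestorSum m n k := by
  induction n with
  | zero => simp [ancestorSum]
  | succ n ih => exact (norm_add_le _ _).trans (add_le_add (ih _) (h _))

/-- Summing the recurrence bounds the sum of `S` by `C` times the sum of `G` plus `ρ` times the sum
of `S` itself; as `ρ < 1`, the last term is absorbed on the left. -/
theorem sum_range_le_of_recurrence {S G : ℕ → ℝ} {C ρ : ℝ} (hS : ∀ n, 0 ≤ S n) (hρ0 : 0 ≤ ρ)
    (hρ : ρ < 1) (h0 : S 0 ≤ C * G 0) (h : ∀ n, S (n + 1) ≤ C * G (n + 1) + ρ * S n) (N : ℕ) :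
    ∑ n ∈ Finset.range N, S n ≤ C / (1 - ρ) * ∑ n ∈ Finset.range N, G n := by
  have key : ∀ N, ∑ n ∈ Finset.range (N + 1), S n ≤
      C * ∑ n ∈ Finset.range (N + 1), G n + ρ * ∑ n ∈ Finset.range N, S n := by
    intro N
    induction N with
    | zero => simpa using h0
    | succ N ih =>
      rw [Finset.sum_range_succ S (N + 1), Finset.sum_range_succ G (N + 1)]
      have := Finset.sum_range_succ S N
      rw [this] at ih ⊢
      linarith [h N]
  have h1 : (1 - ρ) * ∑ n ∈ Finset.range N, S n ≤ C * ∑ n ∈ Finset.range N, G n := by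
    cases N with
    | zero => simp
    | succ N =>
      have := key N
      have h2 : ∑ n ∈ Finset.range N, S n ≤ ∑ n ∈ Finset.range (N + 1), S n := by
        rw [Finset.sum_range_succ]; linarith [hS N]
      nlinarith [mul_le_mul_of_nonneg_left h2 hρ0]
  rw [div_mul_eq_mul_div, le_div_iff₀ (by linarith)]
  linarith

/-- A Hardy inequality on the tree. -/
theorem exists_hardy (p : ℕ) {w : ℝ} (hw : 0 < w) (hpw : w * p < 1) :
    ∃ C, 0 ≤ C ∧ ∀ (m : Edge p → ℝ) (N : ℕ),
      ∑ n ∈ Finset.range N, ∑ k, w ^ n * (ancestorSum m n k + m ⟨n, k⟩) ^ 2 ≤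
        C * ∑ n ∈ Finset.range N, ∑ k, w ^ n * m ⟨n, k⟩ ^ 2 := by
  -- Each edge passes its ancestor sum to `p` children, whose weight has an extra factor `w`, so
  -- squares grow by `w p` per generation. Since `w p < 1`, there is room for the loss `1 + ε` in
  -- the inequality `(x + y)² ≤ (1 + 1/ε) y² + (1 + ε) x²`.
  obtain ⟨ε, hε, hρ⟩ : ∃ ε : ℝ, 0 < ε ∧ (1 + ε) * (w * p) < 1 := by
    refine ⟨(1 - w * p) / 2, by linarith, ?_⟩
    nlinarith [sq_nonneg (1 - w * p), mul_nonneg hw.le (Nat.cast_nonneg (α := ℝ) p)]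
  have hwp : 0 ≤ w * p := by positivity
  refine ⟨(1 + 1 / ε) / (1 - (1 + ε) * (w * p)), div_nonneg (by positivity) (by linarith),
    fun m N => ?_⟩
  refine sum_range_le_of_recurrence (S := fun n => ∑ k, w ^ n * (ancestorSum m n k + m ⟨n, k⟩) ^ 2)
    (G := fun n => ∑ k, w ^ n * m ⟨n, k⟩ ^ 2) (fun n => by positivity) (by positivity) hρ ?_ ?_ N
  · simp only [ancestorSum, zero_add]
    refine le_mul_of_one_le_left (by positivity) ?_
    have : 0 < 1 / ε := by positivity
    linarith
  · intro n
    have hsq : ∀ x y : ℝ, (x + y) ^ 2 ≤ (1 + 1 / ε) * y ^ 2 + (1 + ε) * x ^ 2 := by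
      intro x y
      have h1 : (1 + 1 / ε) * y ^ 2 + (1 + ε) * x ^ 2 - (x + y) ^ 2 = (y - ε * x) ^ 2 / ε := by
        field_simp
        ring
      have h2 : 0 ≤ (y - ε * x) ^ 2 / ε := by positivity
      linarith
    have h3 : (1 + ε) * (w * p) * ∑ k, w ^ n * (ancestorSum m n k + m ⟨n, k⟩) ^ 2 =
        ∑ k : Fin (p ^ (n + 1)), w ^ (n + 1) * ((1 + ε) * (ancestorSum m (n + 1) k) ^ 2) := by
      rw [sum_children]
      simp only [ancestorSum_child, Finset.sum_const, Finset.card_univ, Fintype.card_fin,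
        nsmul_eq_mul]
      rw [Finset.mul_sum]
      exact Finset.sum_congr rfl fun k _ => by ring
    rw [h3, Finset.mul_sum, ← Finset.sum_add_distrib]
    refine Finset.sum_le_sum fun k _ => ?_
    have := mul_le_mul_of_nonneg_left (hsq (ancestorSum m (n + 1) k) (m ⟨n + 1, k⟩))
      (pow_pos hw (n + 1)).le
    linarith

/-! ### The measures on the edges -/

instance (ℓ α : ℝ) (n : ℕ) : IsFiniteMeasure (edgeMeasure ℓ α n) :=
  Measure.smul_finite _ ENNReal.ofReal_ne_top

theorem edgeMeasure_real_univ (h : Admissible p ℓ α) (n : ℕ) :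
    (edgeMeasure ℓ α n).real univ = (α * ℓ) ^ n := by
  have h1 := pow_pos h.α_pos n
  have h2 := pow_pos h.l_pos n
  simp [edgeMeasure, Measure.real, levelStart_succ, mul_pow, h1.le, h2.le]

theorem ae_edgeMeasure_iff (h : Admissible p ℓ α) {n : ℕ} {P : ℝ → Prop} :
    (∀ᵐ t ∂edgeMeasure ℓ α n, P t) ↔
      ∀ᵐ t, t ∈ Ioo (levelStart ℓ n) (levelStart ℓ (n + 1)) → P t := by
  have hα : ENNReal.ofReal (α ^ n) ≠ 0 := by simpa using pow_pos h.α_pos n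
  unfold edgeMeasure
  rw [Measure.ae_ennreal_smul_measure_iff hα, ae_restrict_iff' measurableSet_Ioo]

theorem integral_edgeMeasure {E : Type*} [NormedAddCommGroup E] [NormedSpace ℝ E]
    (h : Admissible p ℓ α) (n : ℕ) (f : ℝ → E) :
    ∫ t, f t ∂edgeMeasure ℓ α n =
      α ^ n • ∫ t in Ioo (levelStart ℓ n) (levelStart ℓ (n + 1)), f t := by
  rw [edgeMeasure, integral_smul_measure, ENNReal.toReal_ofReal (pow_pos h.α_pos n).le]

theorem integrable_edgeMeasure_iff (h : Admissible p ℓ α) {n : ℕ} {f : ℝ → ℂ} :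
    Integrable f (edgeMeasure ℓ α n) ↔
      IntegrableOn f (Ioo (levelStart ℓ n) (levelStart ℓ (n + 1))) := by
  unfold edgeMeasure
  exact integrable_smul_measure (by simpa using pow_pos h.α_pos n) ENNReal.ofReal_ne_top

theorem integrableOn_coeFn (h : Admissible p ℓ α) {n : ℕ} (g : Lp ℂ 2 (edgeMeasure ℓ α n)) :
    IntegrableOn g (Ioo (levelStart ℓ n) (levelStart ℓ (n + 1))) :=
  (integrable_edgeMeasure_iff h).1 ((Lp.memLp g).integrable (by norm_num))

/-- Cauchy–Schwarz on an edge of mass `(αℓ)^n` yields this with the larger factor `(α/ℓ)^n`. The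
weaker form has the weight `(αℓ)^n` for which the Hardy inequality is used. -/
theorem sq_integral_norm_le (h : Admissible p ℓ α) {n : ℕ} (g : Lp ℂ 2 (edgeMeasure ℓ α n)) :
    (α * ℓ) ^ n * (∫ t in Ioo (levelStart ℓ n) (levelStart ℓ (n + 1)), ‖g t‖) ^ 2 ≤ ‖g‖ ^ 2 := by
  have hα := pow_pos h.α_pos n
  have hℓ := pow_pos h.l_pos n
  have h1 : ∫ t, ‖g t‖ ∂edgeMeasure ℓ α n ≤ ‖g‖ * √((α * ℓ) ^ n) := by
    rw [integral_norm_eq_lintegral_enorm (Lp.aestronglyMeasurable g), ← eLpNorm_one_eq_lintegral_enorm,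
      Lp.norm_def, ← edgeMeasure_real_univ h, Measure.real, Real.sqrt_eq_rpow, ENNReal.toReal_rpow,
      ← ENNReal.toReal_mul]
    refine ENNReal.toReal_mono (ENNReal.mul_ne_top (Lp.eLpNorm_ne_top g) (by simp)) ?_
    convert eLpNorm_le_eLpNorm_mul_rpow_measure_univ (p := 1) (q := 2) (by norm_num)
      (Lp.aestronglyMeasurable g) using 3
    norm_num
  rw [integral_edgeMeasure h, smul_eq_mul] at h1
  set I := ∫ t in Ioo (levelStart ℓ n) (levelStart ℓ (n + 1)), ‖g t‖ with hI
  have hI0 : 0 ≤ I := integral_nonneg fun _ => norm_nonneg _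
  have h2 := pow_le_pow_left₀ (by positivity) h1 2
  have hαℓ : 0 < α * ℓ := mul_pos h.α_pos h.l_pos
  rw [mul_pow, mul_pow, Real.sq_sqrt (by positivity), mul_pow α ℓ n] at h2
  have h3 : α ^ n * I ^ 2 ≤ ‖g‖ ^ 2 * ℓ ^ n := by
    nlinarith
  rw [mul_pow]
  have hℓ1 : ℓ ^ n ≤ 1 := pow_le_one₀ h.l_pos.le h.l_lt_one.le
  calc α ^ n * ℓ ^ n * I ^ 2 = ℓ ^ n * (α ^ n * I ^ 2) := by ring
    _ ≤ ℓ ^ n * (‖g‖ ^ 2 * ℓ ^ n) := by gcongr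
    _ = ‖g‖ ^ 2 * (ℓ ^ n) ^ 2 := by ring
    _ ≤ ‖g‖ ^ 2 * 1 := by gcongr; exact pow_le_one₀ hℓ.le hℓ1
    _ = _ := mul_one _

/-! ### Integration along the paths from the root -/

/-- The integral of `g` over an edge. -/
def edgeIntegral (g : TreeL2 p ℓ α) (e : Edge p) : ℂ :=
  ∫ t in Ioo (levelStart ℓ e.1) (levelStart ℓ (e.1 + 1)), g e t

/-- The integral of `g` along the path from the root. -/
def pathIntegral (g : TreeL2 p ℓ α) (e : Edge p) (t : ℝ) : ℂ :=
  ancestorSum (edgeIntegral g) e.1 e.2 + ∫ s in (levelStart ℓ e.1)..t, g e s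

theorem pathIntegral_start (g : TreeL2 p ℓ α) (e : Edge p) :
    pathIntegral g e (levelStart ℓ e.1) = ancestorSum (edgeIntegral g) e.1 e.2 := by
  simp [pathIntegral]

theorem intervalIntegral_eq_edgeIntegral (h : Admissible p ℓ α) (g : TreeL2 p ℓ α) (e : Edge p) :
    ∫ s in (levelStart ℓ e.1)..(levelStart ℓ (e.1 + 1)), g e s = edgeIntegral g e := by
  rw [intervalIntegral.integral_of_le (levelStart_lt_succ h.l_pos _).le,
    integral_Ioc_eq_integral_Ioo, edgeIntegral]

theorem continuousOn_pathIntegral (h : Admissible p ℓ α) (g : TreeL2 p ℓ α) (e : Edge p) :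
    ContinuousOn (pathIntegral g e) (Icc (levelStart ℓ e.1) (levelStart ℓ (e.1 + 1))) :=
  continuousOn_const.add
    (continuousOn_primitive_Ioo (integrableOn_coeFn h (g e)) (levelStart_lt_succ h.l_pos _).le)

theorem isContOnTree_pathIntegral (h : Admissible p ℓ α) (g : TreeL2 p ℓ α) :
    IsContOnTree ℓ (pathIntegral g) := by
  refine ⟨continuousOn_pathIntegral h g, fun e e' he => ?_⟩
  obtain ⟨j, rfl⟩ := he.exists_eq
  rw [pathIntegral, pathIntegral, intervalIntegral_eq_edgeIntegral h, ancestorSum_child,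
    intervalIntegral.integral_same, add_zero]

theorem pathIntegral_add (h : Admissible p ℓ α) (f g : TreeL2 p ℓ α) (e : Edge p) {t : ℝ}
    (ht : t ∈ Icc (levelStart ℓ e.1) (levelStart ℓ (e.1 + 1))) :
    pathIntegral (f + g) e t = pathIntegral f e t + pathIntegral g e t := by
  have hae : ∀ e : Edge p, ∀ᵐ s, s ∈ Ioo (levelStart ℓ e.1) (levelStart ℓ (e.1 + 1)) →
      (f + g) e s = f e s + g e s := fun e =>
    (ae_edgeMeasure_iff h).1 (Lp.coeFn_add (f e) (g e))
  have h1 : edgeIntegral (f + g) = edgeIntegral f + edgeIntegral g := by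
    ext e
    rw [Pi.add_apply, edgeIntegral, edgeIntegral, edgeIntegral,
      ← integral_add (integrableOn_coeFn h (f e)) (integrableOn_coeFn h (g e))]
    exact setIntegral_congr_ae measurableSet_Ioo (hae e)
  have h2 : ∫ s in (levelStart ℓ e.1)..t, (f + g) e s =
      (∫ s in (levelStart ℓ e.1)..t, f e s) + ∫ s in (levelStart ℓ e.1)..t, g e s := by
    rw [← intervalIntegral.integral_add
      (intervalIntegrable_of_Ioo (integrableOn_coeFn h (f e)) (levelStart_mem_Icc h.l_pos _) ht)
      (intervalIntegrable_of_Ioo (integrableOn_coeFn h (g e)) (levelStart_mem_Icc h.l_pos _) ht)]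
    rw [intervalIntegral.integral_of_le ht.1, intervalIntegral.integral_of_le ht.1,
      integral_Ioc_eq_integral_Ioo, integral_Ioc_eq_integral_Ioo]
    refine setIntegral_congr_ae measurableSet_Ioo ?_
    filter_upwards [hae e] with s hs hs' using hs ⟨hs'.1, hs'.2.trans_le ht.2⟩
  rw [pathIntegral, h1, h2, ancestorSum_add, pathIntegral, pathIntegral]
  ring

theorem pathIntegral_smul (h : Admissible p ℓ α) (a : ℂ) (g : TreeL2 p ℓ α) (e : Edge p) {t : ℝ}
    (ht : t ∈ Icc (levelStart ℓ e.1) (levelStart ℓ (e.1 + 1))) :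
    pathIntegral (a • g) e t = a * pathIntegral g e t := by
  have hae : ∀ e : Edge p, ∀ᵐ s, s ∈ Ioo (levelStart ℓ e.1) (levelStart ℓ (e.1 + 1)) →
      (a • g) e s = a * g e s := fun e =>
    (ae_edgeMeasure_iff h).1 (Lp.coeFn_smul a (g e))
  have h1 : edgeIntegral (a • g) = a • edgeIntegral g := by
    ext e
    rw [Pi.smul_apply, edgeIntegral, edgeIntegral, smul_eq_mul, ← integral_const_mul]
    exact setIntegral_congr_ae measurableSet_Ioo (hae e)
  have h2 : ∫ s in (levelStart ℓ e.1)..t, (a • g) e s = a * ∫ s in (levelStart ℓ e.1)..t, g e s := by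
    rw [← intervalIntegral.integral_const_mul]
    rw [intervalIntegral.integral_of_le ht.1, intervalIntegral.integral_of_le ht.1,
      integral_Ioc_eq_integral_Ioo, integral_Ioc_eq_integral_Ioo]
    refine setIntegral_congr_ae measurableSet_Ioo ?_
    filter_upwards [hae e] with s hs hs' using hs ⟨hs'.1, hs'.2.trans_le ht.2⟩
  rw [pathIntegral, h1, h2, ancestorSum_smul, pathIntegral, smul_eq_mul]
  ring

/-- The integral of `|g|` over an edge. -/
def edgeMass (g : TreeL2 p ℓ α) (e : Edge p) : ℝ :=
  ∫ t in Ioo (levelStart ℓ e.1) (levelStart ℓ (e.1 + 1)), ‖g e t‖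

theorem norm_pathIntegral_le (h : Admissible p ℓ α) (g : TreeL2 p ℓ α) (e : Edge p) {t : ℝ}
    (ht : t ∈ Icc (levelStart ℓ e.1) (levelStart ℓ (e.1 + 1))) :
    ‖pathIntegral g e t‖ ≤ ancestorSum (edgeMass g) e.1 e.2 + edgeMass g e := by
  refine (norm_add_le _ _).trans (add_le_add
    (norm_ancestorSum_le (fun e => norm_integral_le_integral_norm _) _ _) ?_)
  rw [intervalIntegral.integral_of_le ht.1, integral_Ioc_eq_integral_Ioo]
  refine (norm_integral_le_integral_norm _).trans ?_
  exact setIntegral_mono_set (integrableOn_coeFn h (g e)).norm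
    (Eventually.of_forall fun _ => norm_nonneg _) (Ioo_subset_Ioo_right ht.2).eventuallyLE

theorem memLp_of_continuousOn {n : ℕ} {F : ℝ → ℂ}
    (hF : ContinuousOn F (Icc (levelStart ℓ n) (levelStart ℓ (n + 1)))) :
    MemLp F 2 (edgeMeasure ℓ α n) := by
  obtain ⟨C, hC⟩ := isCompact_Icc.exists_bound_of_continuousOn hF
  refine MemLp.of_bound (AEStronglyMeasurable.smul_measure ((hF.mono
    Ioo_subset_Icc_self).aestronglyMeasurable measurableSet_Ioo) _) C ?_
  refine Measure.ae_smul_measure ?_ _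
  filter_upwards [ae_restrict_mem measurableSet_Ioo] with t ht
  exact hC t (Ioo_subset_Icc_self ht)

theorem sum_norm_sq_le {ι : Type*} {E : ι → Type*} [∀ i, NormedAddCommGroup (E i)] (f : lp E 2)
    (s : Finset ι) : ∑ i ∈ s, ‖f i‖ ^ 2 ≤ ‖f‖ ^ 2 := by
  simpa using lp.sum_rpow_le_norm_rpow (p := 2) (by simp) f s

theorem memℓp_two_of_sum_le {ι : Type*} {E : ι → Type*} [∀ i, NormedAddCommGroup (E i)]
    {f : ∀ i, E i} {C : ℝ} (h : ∀ s : Finset ι, ∑ i ∈ s, ‖f i‖ ^ 2 ≤ C) : Memℓp f 2 :=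
  memℓp_gen' (C := C) (by simpa using h)

theorem norm_le_of_sum_sq_le {ι : Type*} {E : ι → Type*} [∀ i, NormedAddCommGroup (E i)]
    {f : lp E 2} {C : ℝ} (hC : 0 ≤ C) (h : ∀ s : Finset ι, ∑ i ∈ s, ‖f i‖ ^ 2 ≤ C ^ 2) : ‖f‖ ≤ C :=
  lp.norm_le_of_forall_sum_le (by simp) hC (by simpa using h)

theorem exists_subset_sigma (s : Finset (Edge p)) :
    ∃ N, s ⊆ (Finset.range N).sigma fun _ => Finset.univ := by
  refine ⟨s.sup (fun e => e.1) + 1, fun e he => ?_⟩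
  simpa using Nat.lt_succ_of_le (Finset.le_sup (f := fun e : Edge p => e.1) he)

/-- The function `x ↦ ∫_o^x g` on an edge. -/
def pathLp (h : Admissible p ℓ α) (g : TreeL2 p ℓ α) (e : Edge p) :
    Lp ℂ 2 (edgeMeasure ℓ α e.1) :=
  (memLp_of_continuousOn (continuousOn_pathIntegral h g e)).toLp _

theorem pathLp_ae_eq (h : Admissible p ℓ α) (g : TreeL2 p ℓ α) (e : Edge p) :
    (pathLp h g e : ℝ → ℂ) =ᵐ[edgeMeasure ℓ α e.1] pathIntegral g e :=
  MemLp.coeFn_toLp _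

theorem ae_mem_Ioo (h : Admissible p ℓ α) (n : ℕ) :
    ∀ᵐ t ∂edgeMeasure ℓ α n, t ∈ Ioo (levelStart ℓ n) (levelStart ℓ (n + 1)) :=
  (ae_edgeMeasure_iff h).2 (Eventually.of_forall fun _ => id)

theorem norm_pathLp_sq_le (h : Admissible p ℓ α) (g : TreeL2 p ℓ α) (e : Edge p) :
    ‖pathLp h g e‖ ^ 2 ≤
      (α * ℓ) ^ e.1 * (ancestorSum (edgeMass g) e.1 e.2 + edgeMass g e) ^ 2 := by
  have h0 : 0 < α * ℓ := mul_pos h.α_pos h.l_pos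
  have h1 : 0 ≤ ancestorSum (edgeMass g) e.1 e.2 + edgeMass g e :=
    (norm_nonneg _).trans (norm_pathIntegral_le h g e (levelStart_mem_Icc h.l_pos _))
  have h2 := Lp.norm_le_of_ae_bound (f := pathLp h g e) h1 (by
    filter_upwards [pathLp_ae_eq h g e, ae_mem_Ioo h e.1] with t ht ht'
    rw [ht]
    exact norm_pathIntegral_le h g e (Ioo_subset_Icc_self ht'))
  have h3 := pow_le_pow_left₀ (norm_nonneg _) h2 2
  rw [mul_pow] at h3
  refine h3.trans_eq ?_
  congr 1
  have h4 : ((measureUnivNNReal (edgeMeasure ℓ α e.1) : NNReal) : ℝ) = (α * ℓ) ^ e.1 :=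
    edgeMeasure_real_univ h e.1
  rw [h4, ENNReal.toReal_ofNat, ← Real.rpow_natCast _ 2,
    ← Real.rpow_mul (by positivity)]
  norm_num

/-- This is the Hardy inequality with `w = αℓ`, whose hypothesis `w p < 1` is the assumption `αpℓ <
1`. On each edge the path integral is bounded by the sum of the masses up to and including that
edge. -/
theorem exists_poincare (h : Admissible p ℓ α) : ∃ C, 0 ≤ C ∧ ∀ (g : TreeL2 p ℓ α)
    (s : Finset (Edge p)), ∑ e ∈ s, ‖pathLp h g e‖ ^ 2 ≤ (C * ‖g‖) ^ 2 := by
  have h0 : 0 < α * ℓ := mul_pos h.α_pos h.l_pos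
  obtain ⟨C, hC, H⟩ := exists_hardy p h0 (by linarith [h.mul_lt])
  refine ⟨√C, Real.sqrt_nonneg _, fun g s => ?_⟩
  rw [mul_pow, Real.sq_sqrt hC]
  obtain ⟨N, hN⟩ := exists_subset_sigma s
  calc ∑ e ∈ s, ‖pathLp h g e‖ ^ 2
      ≤ ∑ e ∈ (Finset.range N).sigma fun _ => Finset.univ, ‖pathLp h g e‖ ^ 2 :=
        Finset.sum_le_sum_of_subset_of_nonneg hN fun _ _ _ => by positivity
    _ ≤ ∑ e ∈ (Finset.range N).sigma fun _ => Finset.univ,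
        (α * ℓ) ^ e.1 * (ancestorSum (edgeMass g) e.1 e.2 + edgeMass g e) ^ 2 :=
        Finset.sum_le_sum fun e _ => norm_pathLp_sq_le h g e
    _ = ∑ n ∈ Finset.range N, ∑ k,
        (α * ℓ) ^ n * (ancestorSum (edgeMass g) n k + edgeMass g ⟨n, k⟩) ^ 2 :=
        Finset.sum_sigma _ _ _
    _ ≤ C * ∑ n ∈ Finset.range N, ∑ k, (α * ℓ) ^ n * edgeMass g ⟨n, k⟩ ^ 2 := H _ _
    _ ≤ C * ∑ n ∈ Finset.range N, ∑ k, ‖g ⟨n, k⟩‖ ^ 2 := by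
        gcongr with n _ k
        exact sq_integral_norm_le h (g ⟨n, k⟩)
    _ = C * ∑ e ∈ (Finset.range N).sigma fun _ => Finset.univ, ‖g e‖ ^ 2 := by
        rw [Finset.sum_sigma]
    _ ≤ C * ‖g‖ ^ 2 := by gcongr; exact sum_norm_sq_le g _

/-- The function `x ↦ ∫_o^x g` on the tree. -/
def primitiveFn (h : Admissible p ℓ α) : TreeL2 p ℓ α →ₗ[ℂ] TreeL2 p ℓ α where
  toFun g := ⟨fun e => pathLp h g e, memℓp_two_of_sum_le ((exists_poincare h).choose_spec.2 g)⟩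
  map_add' f g := by
    apply Subtype.ext
    funext e
    apply Lp.ext
    change (pathLp h (f + g) e : ℝ → ℂ) =ᵐ[_] (pathLp h f e + pathLp h g e : Lp ℂ 2 _)
    filter_upwards [pathLp_ae_eq h (f + g) e, pathLp_ae_eq h f e, pathLp_ae_eq h g e,
      Lp.coeFn_add (pathLp h f e) (pathLp h g e), ae_mem_Ioo h e.1] with t h1 h2 h3 h4 h5
    rw [h1, h4, Pi.add_apply, h2, h3, pathIntegral_add h f g e (Ioo_subset_Icc_self h5)]
  map_smul' c g := by
    apply Subtype.ext
    funext e
    apply Lp.ext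
    change (pathLp h (c • g) e : ℝ → ℂ) =ᵐ[_] (c • pathLp h g e : Lp ℂ 2 _)
    filter_upwards [pathLp_ae_eq h (c • g) e, pathLp_ae_eq h g e,
      Lp.coeFn_smul c (pathLp h g e), ae_mem_Ioo h e.1] with t h1 h2 h4 h5
    rw [h1, h4, Pi.smul_apply, h2, pathIntegral_smul h c g e (Ioo_subset_Icc_self h5), smul_eq_mul]

theorem norm_primitiveFn_le (h : Admissible p ℓ α) (g : TreeL2 p ℓ α) :
    ‖primitiveFn h g‖ ≤ (exists_poincare h).choose * ‖g‖ :=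
  norm_le_of_sum_sq_le (mul_nonneg (exists_poincare h).choose_spec.1 (norm_nonneg _))
    ((exists_poincare h).choose_spec.2 g)

theorem represents_primitiveFn (h : Admissible p ℓ α) (g : TreeL2 p ℓ α) :
    Represents (primitiveFn h g) (pathIntegral g) := fun e => pathLp_ae_eq h g e

theorem represents_self (g : TreeL2 p ℓ α) : Represents g fun e => g e := fun _ => EventuallyEq.rfl

theorem isWeakDeriv_pathIntegral (h : Admissible p ℓ α) (g : TreeL2 p ℓ α) (e : Edge p) :
    IsWeakDeriv (levelStart ℓ e.1) (levelStart ℓ (e.1 + 1)) (pathIntegral g e) (g e) :=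
  isWeakDeriv_primitive (levelStart_lt_succ h.l_pos _).le (integrableOn_coeFn h (g e)) _

/-- The primitive `x ↦ ∫_o^x g` as an element of `H¹`. -/
def primitive (h : Admissible p ℓ α) : TreeL2 p ℓ α →L[ℂ] H1 p ℓ α :=
  ((WithLp.prodContinuousLinearEquiv 2 ℂ (TreeL2 p ℓ α) (TreeL2 p ℓ α)).symm.toContinuousLinearMap ∘L
    (((primitiveFn h).mkContinuous _ (norm_primitiveFn_le h)).prod
      (ContinuousLinearMap.id ℂ _))).codRestrict (sobolevH1 p ℓ α) fun g =>
    ⟨pathIntegral g, fun e => g e, represents_primitiveFn h g, represents_self g,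
      isContOnTree_pathIntegral h g, isWeakDeriv_pathIntegral h g⟩

/-- The map `f ↦ f'`. -/
def derL (p : ℕ) (ℓ α : ℝ) : H1 p ℓ α →L[ℂ] TreeL2 p ℓ α :=
  WithLp.sndL 2 ℂ (TreeL2 p ℓ α) (TreeL2 p ℓ α) ∘L (sobolevH1 p ℓ α).subtypeL

@[simp]
theorem derL_apply (u : H1 p ℓ α) : derL p ℓ α u = u.der := rfl

@[simp]
theorem der_primitive (h : Admissible p ℓ α) (g : TreeL2 p ℓ α) : (primitive h g).der = g := rfl

theorem represents_primitive (h : Admissible p ℓ α) (g : TreeL2 p ℓ α) :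
    Represents (primitive h g).fn (pathIntegral g) := represents_primitiveFn h g

theorem pathIntegral_root (g : TreeL2 p ℓ α) : pathIntegral g (rootEdge p) 0 = 0 := by
  have := pathIntegral_start g (rootEdge p)
  rw [show levelStart ℓ (rootEdge p).1 = 0 from levelStart_zero ℓ] at this
  rw [this]
  rfl

theorem primitive_mem_H1t (h : Admissible p ℓ α) (g : TreeL2 p ℓ α) : primitive h g ∈ H1t p ℓ α :=
  ⟨pathIntegral g, represents_primitive h g, isContOnTree_pathIntegral h g, pathIntegral_root g⟩

theorem H1.ext {u v : H1 p ℓ α} (h1 : u.fn = v.fn) (h2 : u.der = v.der) : u = v :=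
  Subtype.ext ((WithLp.ofLp_injective 2) (Prod.ext h1 h2))

/-! ### Splitting `H¹` into constants and primitives. -/

theorem norm_const_sq (h : Admissible p ℓ α) (n : ℕ) (c : ℂ) :
    ‖Lp.const 2 (edgeMeasure ℓ α n) c‖ ^ 2 = (α * ℓ) ^ n * ‖c‖ ^ 2 := by
  have h0 : 0 < α * ℓ := mul_pos h.α_pos h.l_pos
  rw [Lp.norm_const' _ _ _ (by norm_num) (by norm_num), edgeMeasure_real_univ h, mul_pow,
    ENNReal.toReal_ofNat, ← Real.rpow_natCast _ 2, ← Real.rpow_natCast _ 2,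
    ← Real.rpow_mul (by positivity)]
  norm_num
  ring

/-- The condition `∑_e (αℓ)^n |c_e|² < ∞`, in terms of partial sums over generations. -/
theorem memℓp_const (h : Admissible p ℓ α) {c : Edge p → ℂ} {C : ℝ}
    (hc : ∀ N, ∑ n ∈ Finset.range N, ∑ k, (α * ℓ) ^ n * ‖c ⟨n, k⟩‖ ^ 2 ≤ C) :
    Memℓp (fun e : Edge p => Lp.const 2 (edgeMeasure ℓ α e.1) (c e)) 2 := by
  refine memℓp_two_of_sum_le (C := C) fun s => ?_
  obtain ⟨N, hN⟩ := exists_subset_sigma s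
  refine (Finset.sum_le_sum_of_subset_of_nonneg hN fun _ _ _ => by positivity).trans ?_
  simp only [norm_const_sq h]
  rw [Finset.sum_sigma]
  exact hc N

theorem geom_sum_le {r : ℝ} (h0 : 0 ≤ r) (h1 : r < 1) (N : ℕ) :
    ∑ n ∈ Finset.range N, r ^ n ≤ (1 - r)⁻¹ :=
  (Summable.sum_le_tsum _ (fun _ _ => by positivity)
    (summable_geometric_of_lt_one h0 h1)).trans_eq (tsum_geometric_of_lt_one h0 h1)

/-- The tree has finite total mass: generation `n` contributes `(αpℓ)^n`. -/
theorem memℓp_one (h : Admissible p ℓ α) :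
    Memℓp (fun e : Edge p => Lp.const 2 (edgeMeasure ℓ α e.1) (1 : ℂ)) 2 := by
  have h0 : 0 < α * ℓ := mul_pos h.α_pos h.l_pos
  refine memℓp_const h (c := fun _ => 1) (C := (1 - α * p * ℓ)⁻¹) fun N => ?_
  refine le_trans (le_of_eq ?_) (geom_sum_le (r := α * p * ℓ) ?_ h.mul_lt N)
  · refine Finset.sum_congr rfl fun n _ => ?_
    simp
    ring
  · have := h.α_pos
    have := h.l_pos
    positivity

theorem represents_const {c : Edge p → ℂ}
    (hc : Memℓp (fun e : Edge p => Lp.const 2 (edgeMeasure ℓ α e.1) (c e)) 2) :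
    Represents (⟨_, hc⟩ : TreeL2 p ℓ α) fun e _ => c e := fun _ => Lp.coeFn_const _ _ _

/-- The constant function `1` on the tree. -/
def oneH1 (h : Admissible p ℓ α) : H1 p ℓ α :=
  ⟨WithLp.toLp 2 ((⟨_, memℓp_one h⟩ : TreeL2 p ℓ α), (0 : TreeL2 p ℓ α)),
    fun _ _ => 1, 0, represents_const (c := fun _ => 1) _, represents_zero p ℓ α,
    ⟨fun _ => continuousOn_const, fun _ _ _ => rfl⟩, fun e => by
      simpa using! isWeakDeriv_primitive (levelStart_lt_succ h.l_pos e.1).le (integrableOn_zero) 1⟩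

@[simp]
theorem der_oneH1 (h : Admissible p ℓ α) : (oneH1 h).der = 0 := rfl

theorem represents_oneH1 (h : Admissible p ℓ α) : Represents (oneH1 h).fn fun _ _ => 1 :=
  represents_const (c := fun _ => 1) _

theorem oneH1_ne_zero (h : Admissible p ℓ α) : oneH1 h ≠ 0 := by
  intro h0
  have h1 : (oneH1 h).fn (rootEdge p) = 0 := by rw [h0]; rfl
  have h2 := norm_const_sq h 0 1
  change Lp.const 2 (edgeMeasure ℓ α 0) (1 : ℂ) = 0 at h1
  rw [h1] at h2
  simp at h2

theorem eqOn_of_ae_eq (h : Admissible p ℓ α) {n : ℕ} {F G : ℝ → ℂ} (hFG : F =ᵐ[edgeMeasure ℓ α n] G)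
    (hF : ContinuousOn F (Icc (levelStart ℓ n) (levelStart ℓ (n + 1))))
    (hG : ContinuousOn G (Icc (levelStart ℓ n) (levelStart ℓ (n + 1)))) :
    EqOn F G (Icc (levelStart ℓ n) (levelStart ℓ (n + 1))) := by
  refine Measure.eqOn_Icc_of_ae_eq volume (levelStart_lt_succ h.l_pos _).ne ?_ hF hG
  rw [← restrict_Ioo_eq_restrict_Icc]
  exact (ae_restrict_iff' measurableSet_Ioo).2 ((ae_edgeMeasure_iff h).1 hFG)

theorem Represents.eqOn (h : Admissible p ℓ α) {f : TreeL2 p ℓ α} {F G : Edge p → ℝ → ℂ}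
    (hF : Represents f F) (hG : Represents f G) (hF' : IsContOnTree ℓ F) (hG' : IsContOnTree ℓ G)
    (e : Edge p) : EqOn (F e) (G e) (Icc (levelStart ℓ e.1) (levelStart ℓ (e.1 + 1))) :=
  eqOn_of_ae_eq h ((hF e).symm.trans (hG e)) (hF'.continuousOn e) (hG'.continuousOn e)

theorem zero_mem_root_Icc (h : Admissible p ℓ α) :
    (0 : ℝ) ∈ Icc (levelStart ℓ (rootEdge p).1) (levelStart ℓ ((rootEdge p).1 + 1)) := by
  have := levelStart_mem_Icc h.l_pos 0
  rwa [levelStart_zero] at this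

/-- A function in `H¹` with continuous representative `F` is `F(o)` plus a primitive of its
derivative. -/
theorem eq_const_add_pathIntegral (h : Admissible p ℓ α) (u : H1 p ℓ α) {F : Edge p → ℝ → ℂ}
    (hF : Represents u.fn F) (hF' : IsContOnTree ℓ F) (e : Edge p) {t : ℝ}
    (ht : t ∈ Icc (levelStart ℓ e.1) (levelStart ℓ (e.1 + 1))) :
    F e t = F (rootEdge p) 0 + pathIntegral u.der e t := by
  obtain ⟨F₁, G, h1, h2, h3, h4⟩ := u.2
  have heq := Represents.eqOn h hF h1 hF' h3
  have hedge : ∀ (e : Edge p) (t : ℝ), t ∈ Icc (levelStart ℓ e.1) (levelStart ℓ (e.1 + 1)) →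
      F e t = F e (levelStart ℓ e.1) + ∫ s in (levelStart ℓ e.1)..t, u.der e s := by
    intro e t ht
    rw [heq e ht, heq e (levelStart_mem_Icc h.l_pos _),
      (h4 e).eq_primitive (levelStart_lt_succ h.l_pos _) (h3.continuousOn e) ht]
    congr 1
    rw [intervalIntegral.integral_of_le ht.1, intervalIntegral.integral_of_le ht.1,
      integral_Ioc_eq_integral_Ioo, integral_Ioc_eq_integral_Ioo]
    refine setIntegral_congr_ae measurableSet_Ioo ?_
    filter_upwards [(ae_edgeMeasure_iff h).1 (h2 e)] with s hs hs'
      using (hs ⟨hs'.1, hs'.2.trans_le ht.2⟩).symm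
  -- The edgewise formula is propagated away from the root through the vertex conditions, generation
  -- by generation.
  have hstart : ∀ (n : ℕ) (k : Fin (p ^ n)), F ⟨n, k⟩ (levelStart ℓ n) =
      F (rootEdge p) 0 + ancestorSum (edgeIntegral u.der) n k := by
    intro n
    induction n with
    | zero =>
      intro k
      rw [edge_zero_eq k, levelStart_zero]
      simp [ancestorSum]
    | succ n ih =>
      intro k
      obtain ⟨i, j, rfl⟩ := exists_child_eq k
      rw [← hF'.vertex _ _ (isChild_child i j), hedge _ _ (levelStart_succ_mem_Icc h.l_pos n),
        ih i, ancestorSum_child, intervalIntegral_eq_edgeIntegral h, add_assoc]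
  rw [hedge e t ht, hstart, pathIntegral, add_assoc]

theorem Represents.fn_eq {f g : TreeL2 p ℓ α} {F : Edge p → ℝ → ℂ} (hf : Represents f F)
    (hg : Represents g F) : f = g := by
  apply Subtype.ext
  funext e
  exact Lp.ext ((hf e).trans (hg e).symm)

theorem exists_eq_smul_add_primitive (h : Admissible p ℓ α) (u : H1 p ℓ α) :
    ∃ c : ℂ, u = c • oneH1 h + primitive h u.der := by
  obtain ⟨F, G, h1, h2, h3, h4⟩ := u.2
  refine ⟨F (rootEdge p) 0, H1.ext (lp.ext ?_) ?_⟩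
  · have hr := ((represents_oneH1 h).smul (F (rootEdge p) 0)).add (represents_primitive h u.der)
    funext e
    apply Lp.ext
    refine (h1 e).trans (EventuallyEq.trans ?_ (hr e).symm)
    filter_upwards [ae_mem_Ioo h e.1] with t ht
    rw [eq_const_add_pathIntegral h u h1 h3 e (Ioo_subset_Icc_self ht)]
    simp
  · change u.der = F (rootEdge p) 0 • (0 : TreeL2 p ℓ α) + u.der
    simp

/-- The evaluation of a function in `H¹` at the root. -/
def evalRoot (h : Admissible p ℓ α) : H1 p ℓ α →L[ℂ] ℂ :=
  (((‖oneH1 h‖ : ℂ) ^ 2)⁻¹) • (innerSL ℂ (oneH1 h) ∘L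
    (ContinuousLinearMap.id ℂ (H1 p ℓ α) - primitive h ∘L derL p ℓ α))

/-- `u - primitive h u.der` is a multiple of the function `1`, and the inner product with `1` reads
off the factor. Defined in this way, evaluation at the root is continuous by construction. -/
theorem eq_evalRoot_smul_add (h : Admissible p ℓ α) (u : H1 p ℓ α) :
    u = evalRoot h u • oneH1 h + primitive h u.der := by
  obtain ⟨c, hc⟩ := exists_eq_smul_add_primitive h u
  have h1 : u - primitive h u.der = c • oneH1 h := sub_eq_iff_eq_add.2 hc
  have h2 : evalRoot h u = c := by
    have hn : ((‖oneH1 h‖ : ℂ) ^ 2) ≠ 0 := by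
      simpa using oneH1_ne_zero h
    have h3 : evalRoot h u =
        ((‖oneH1 h‖ : ℂ) ^ 2)⁻¹ * inner ℂ (oneH1 h) (u - primitive h u.der) := rfl
    have h4 : inner ℂ (oneH1 h) (c • oneH1 h) = c * (‖oneH1 h‖ : ℂ) ^ 2 := by
      have h5 : inner ℂ (oneH1 h) (oneH1 h) = (‖oneH1 h‖ : ℂ) ^ 2 :=
        inner_self_eq_norm_sq_to_K (𝕜 := ℂ) (oneH1 h)
      rw [← h5]
      exact inner_smul_right (𝕜 := ℂ) (E := H1 p ℓ α) (oneH1 h) (oneH1 h) c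
    rw [h3, h1, h4, mul_comm c, inv_mul_cancel_left₀ hn]
  rw [h2]
  exact hc

theorem represents_fn (h : Admissible p ℓ α) (u : H1 p ℓ α) :
    Represents u.fn fun e t => evalRoot h u + pathIntegral u.der e t := by
  have hr := ((represents_oneH1 h).smul (evalRoot h u)).add (represents_primitive h u.der)
  have he : u.fn = evalRoot h u • (oneH1 h).fn + (primitive h u.der).fn :=
    congrArg H1.fn (eq_evalRoot_smul_add h u)
  rw [he]
  convert hr using 1
  ext e t
  simp

theorem isContOnTree_rep (h : Admissible p ℓ α) (u : H1 p ℓ α) :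
    IsContOnTree ℓ fun e t => evalRoot h u + pathIntegral u.der e t := by
  have h1 := isContOnTree_pathIntegral h u.der
  exact ⟨fun e => continuousOn_const.add (h1.1 e), fun e e' he => by rw [h1.2 e e' he]⟩

theorem mem_H1t_iff (h : Admissible p ℓ α) {u : H1 p ℓ α} :
    u ∈ H1t p ℓ α ↔ evalRoot h u = 0 := by
  constructor
  · rintro ⟨F, h1, h2, h3⟩
    have := Represents.eqOn h h1 (represents_fn h u) h2 (isContOnTree_rep h u) _
      (zero_mem_root_Icc h)
    simpa [h3, pathIntegral_root] using this.symm
  · intro h0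
    refine ⟨_, represents_fn h u, isContOnTree_rep h u, ?_⟩
    simp [h0, pathIntegral_root]

theorem eq_primitive_of_mem_H1t (h : Admissible p ℓ α) {u : H1 p ℓ α} (hu : u ∈ H1t p ℓ α) :
    u = primitive h u.der := by
  have := eq_evalRoot_smul_add h u
  rwa [(mem_H1t_iff h).1 hu, zero_smul, zero_add] at this

/-- An element of `H1` is a pair, and uniqueness of weak derivatives shows that its first component
determines it. This identifies the unspecified elements `φ z` in `IsTheta`. -/
theorem eq_zero_of_fn_eq_zero (h : Admissible p ℓ α) {u : H1 p ℓ α} (hu : u.fn = 0) : u = 0 := by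
  obtain ⟨F, G, h1, h2, h3, h4⟩ := u.2
  refine H1.ext hu (lp.ext ?_)
  funext e
  apply Lp.ext
  have hz : ∀ᵐ t, t ∈ Ioo (levelStart ℓ e.1) (levelStart ℓ (e.1 + 1)) → F e t = 0 := by
    refine (ae_edgeMeasure_iff h).1 ?_
    have h5 : Represents (0 : TreeL2 p ℓ α) F := hu ▸ h1
    filter_upwards [h5 e, represents_zero p ℓ α e] with t h6 h7
    rw [← h6, h7]
    rfl
  filter_upwards [h2 e, represents_zero p ℓ α e, (ae_edgeMeasure_iff h).2 ((h4 e).ae_eq_zero hz)]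
    with t h6 h7 h8
  exact h6.trans (h8.trans h7.symm)

/-! ### Kirchhoff step functions and Green's formula. -/

open ComplexConjugate

/-- The step function on the tree with the values `c_e`. -/
def stepFn {c : Edge p → ℂ}
    (hc : Memℓp (fun e : Edge p => Lp.const 2 (edgeMeasure ℓ α e.1) (c e)) 2) : TreeL2 p ℓ α :=
  ⟨_, hc⟩

theorem inner_const_left (h : Admissible p ℓ α) {n : ℕ} (c : ℂ) (g : Lp ℂ 2 (edgeMeasure ℓ α n)) :
    inner ℂ (Lp.const 2 (edgeMeasure ℓ α n) c) g =
      conj c * (α : ℂ) ^ n * ∫ t in Ioo (levelStart ℓ n) (levelStart ℓ (n + 1)), g t := by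
  have h1 : inner ℂ (Lp.const 2 (edgeMeasure ℓ α n) c) g =
      ∫ t, conj c * g t ∂edgeMeasure ℓ α n := by
    rw [L2.inner_def]
    refine integral_congr_ae ?_
    filter_upwards [Lp.coeFn_const 2 (edgeMeasure ℓ α n) c] with t ht
    rw [ht, RCLike.inner_apply, Function.const_apply, mul_comm]
  rw [h1, integral_edgeMeasure h, integral_const_mul, Complex.real_smul]
  push_cast
  ring

/-- Grouping the edges by generation prepares the summation by parts in `IsKirchhoff.sum_range_eq`
and the geometric series in `inner_slopeFn_stepFn`. -/
theorem hasSum_inner_stepFn (h : Admissible p ℓ α) {c : Edge p → ℂ}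
    (hc : Memℓp (fun e : Edge p => Lp.const 2 (edgeMeasure ℓ α e.1) (c e)) 2) (g : TreeL2 p ℓ α) :
    HasSum (fun n => ∑ k, conj (c ⟨n, k⟩) * (α : ℂ) ^ n * edgeIntegral g ⟨n, k⟩)
      (inner ℂ (stepFn hc) g) := by
  have h1 := (lp.hasSum_inner (𝕜 := ℂ) (stepFn hc) g).sigma fun n => hasSum_fintype _
  exact h1.congr_fun fun n => Finset.sum_congr rfl fun k _ =>
    (inner_const_left h (c ⟨n, k⟩) (g ⟨n, k⟩)).symm

theorem edgeIntegral_stepFn (h : Admissible p ℓ α) {c : Edge p → ℂ}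
    (hc : Memℓp (fun e : Edge p => Lp.const 2 (edgeMeasure ℓ α e.1) (c e)) 2) (e : Edge p) :
    edgeIntegral (stepFn hc) e = (ℓ : ℂ) ^ e.1 * c e := by
  have hae := (ae_edgeMeasure_iff h).1 (Lp.coeFn_const 2 (edgeMeasure ℓ α e.1) (c e))
  have h1 := setIntegral_congr_ae (f := (stepFn hc e : ℝ → ℂ)) (g := fun _ => c e)
    measurableSet_Ioo hae
  have hℓ := pow_pos h.l_pos e.1
  rw [edgeIntegral, h1]
  simp [levelStart_succ, hℓ.le]

theorem pathIntegral_stepFn (h : Admissible p ℓ α) {c : Edge p → ℂ}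
    (hc : Memℓp (fun e : Edge p => Lp.const 2 (edgeMeasure ℓ α e.1) (c e)) 2) (e : Edge p) {t : ℝ}
    (ht : t ∈ Icc (levelStart ℓ e.1) (levelStart ℓ (e.1 + 1))) :
    pathIntegral (stepFn hc) e t =
      ancestorSum (edgeIntegral (stepFn hc)) e.1 e.2 + (t - levelStart ℓ e.1 : ℝ) * c e := by
  have hae := (ae_edgeMeasure_iff h).1 (Lp.coeFn_const 2 (edgeMeasure ℓ α e.1) (c e))
  have h1 : ∫ s in (levelStart ℓ e.1)..t, stepFn hc e s = (t - levelStart ℓ e.1 : ℝ) * c e := by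
    rw [intervalIntegral.integral_of_le ht.1, integral_Ioc_eq_integral_Ioo,
      setIntegral_congr_ae (g := fun _ => c e) measurableSet_Ioo]
    · simp [ht.1]
    · filter_upwards [hae] with s hs hs' using hs ⟨hs'.1, hs'.2.trans_le ht.2⟩
  rw [pathIntegral, h1]

/-- The Kirchhoff condition at all the vertices of the tree except the root. -/
def IsKirchhoff (α : ℝ) (c : Edge p → ℂ) : Prop :=
  ∀ (n : ℕ) (k : Fin (p ^ n)), (α : ℂ) * ∑ j, c ⟨n + 1, child k j⟩ = c ⟨n, k⟩

theorem sum_fin_pow_zero {E : Type*} [AddCommMonoid E] (f : Fin (p ^ 0) → E) (k : Fin (p ^ 0)) :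
    ∑ k, f k = f k := by
  have : Subsingleton (Fin (p ^ 0)) := by
    rw [pow_zero]; infer_instance
  exact Fintype.sum_subsingleton _ _

theorem sum_root {E : Type*} [AddCommMonoid E] (f : Edge p → E) :
    ∑ k : Fin (p ^ 0), f ⟨0, k⟩ = f (rootEdge p) :=
  sum_fin_pow_zero (fun k => f ⟨0, k⟩) _

/-- Kirchhoff's condition conserves the total flux from one generation to the next. -/
theorem IsKirchhoff.sum_generation {c : Edge p → ℂ} (hK : IsKirchhoff α c) (n : ℕ) :
    ∑ k, (α : ℂ) ^ n * c ⟨n, k⟩ = c (rootEdge p) := by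
  induction n with
  | zero => simpa using sum_root c
  | succ n ih =>
    rw [← ih, sum_children]
    refine Finset.sum_congr rfl fun k _ => ?_
    rw [← hK n k, ← Finset.mul_sum]
    ring

/-- Summation by parts on the tree: by Kirchhoff's condition the weight of an edge is the sum of the
weights of its descendants in generation `N`, so each increment `d e` can be moved to all of these
and collected there in the ancestor sums. -/
theorem IsKirchhoff.sum_range_eq {c : Edge p → ℂ} (hK : IsKirchhoff α c) (d : Edge p → ℂ) (N : ℕ) :
    ∑ n ∈ Finset.range N, ∑ k, conj (c ⟨n, k⟩) * (α : ℂ) ^ n * d ⟨n, k⟩ =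
      ∑ k, conj (c ⟨N, k⟩) * (α : ℂ) ^ N * ancestorSum d N k := by
  induction N with
  | zero => simp [ancestorSum]
  | succ N ih =>
    rw [Finset.sum_range_succ, ih, ← Finset.sum_add_distrib, sum_children]
    refine Finset.sum_congr rfl fun k _ => ?_
    simp only [ancestorSum_child]
    rw [← hK N k, map_mul, map_sum, Complex.conj_ofReal, Finset.mul_sum, ← mul_add,
      Finset.sum_mul, Finset.sum_mul]
    exact Finset.sum_congr rfl fun j _ => by ring

theorem ancestorSum_eq_of_fn_eq_zero (h : Admissible p ℓ α) {u : H1 p ℓ α} {e : Edge p}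
    (he : u.fn e = 0) : ancestorSum (edgeIntegral u.der) e.1 e.2 = - evalRoot h u := by
  have h1 := represents_fn h u e
  rw [he] at h1
  have h2 := eqOn_of_ae_eq h (h1.symm.trans (Lp.coeFn_zero _ _ _))
    ((isContOnTree_rep h u).continuousOn e) continuousOn_const (levelStart_mem_Icc h.l_pos _)
  simp only [pathIntegral_start] at h2
  exact eq_neg_of_add_eq_zero_right h2

/-- Green's formula for step functions satisfying the Kirchhoff condition and functions of compact
support. -/
theorem IsKirchhoff.inner_der_eq (h : Admissible p ℓ α) {c : Edge p → ℂ} (hK : IsKirchhoff α c)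
    (hc : Memℓp (fun e : Edge p => Lp.const 2 (edgeMeasure ℓ α e.1) (c e)) 2) {u : H1 p ℓ α}
    (hu : u ∈ H10 p ℓ α) :
    inner ℂ (stepFn hc) u.der + conj (c (rootEdge p)) * evalRoot h u = 0 := by
  -- The identity says that a continuous functional vanishes, so it only has to be checked on the
  -- dense subspace `H1c`.
  let Λ : H1 p ℓ α →L[ℂ] ℂ :=
    innerSL ℂ (stepFn hc) ∘L derL p ℓ α + conj (c (rootEdge p)) • evalRoot h
  have hΛ : H1c p ℓ α ≤ LinearMap.ker Λ.toLinearMap := by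
    rintro v ⟨M, hM⟩
    change inner ℂ (stepFn hc) v.der + conj (c (rootEdge p)) * evalRoot h v = 0
    have h1 := (hasSum_inner_stepFn h hc v.der).tendsto_sum_nat
    simp only [hK.sum_range_eq] at h1
    -- Beyond the support every ancestor sum equals `-v(o)`, so the partial sums are constant by
    -- conservation of flux.
    have h2 : ∀ N > M, ∑ k, conj (c ⟨N, k⟩) * (α : ℂ) ^ N * ancestorSum (edgeIntegral v.der) N k =
        - (conj (c (rootEdge p)) * evalRoot h v) := by
      intro N hN
      rw [← hK.sum_generation N, map_sum, Finset.sum_mul, ← Finset.sum_neg_distrib]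
      refine Finset.sum_congr rfl fun k _ => ?_
      rw [ancestorSum_eq_of_fn_eq_zero h (hM ⟨N, k⟩ hN)]
      simp only [map_mul, map_pow, Complex.conj_ofReal]
      ring
    have h3 := tendsto_nhds_unique h1 (tendsto_const_nhds.congr' (by
      filter_upwards [eventually_gt_atTop M] with N hN using (h2 N hN).symm))
    rw [h3]
    ring
  exact Submodule.topologicalClosure_minimal _ hΛ Λ.isClosed_ker hu

/-! ### Roots of unity -/

theorem theta_eq_pow (p s : ℕ) : theta p s = Complex.exp (2 * Real.pi * Complex.I / p) ^ s := by
  rw [theta, mul_comm, Complex.exp_nat_mul]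

theorem theta_pow_card (hp : p ≠ 0) (s : ℕ) : theta p s ^ p = 1 := by
  rw [theta_eq_pow, ← pow_mul, mul_comm s, pow_mul, (Complex.isPrimitiveRoot_exp p hp).pow_eq_one,
    one_pow]

theorem theta_injOn (hp : p ≠ 0) {s s' : ℕ} (hs : s < p) (hs' : s' < p)
    (h : theta p s = theta p s') : s = s' := by
  rw [theta_eq_pow, theta_eq_pow] at h
  exact (Complex.isPrimitiveRoot_exp p hp).pow_inj hs hs' h

theorem theta_zero (p : ℕ) : theta p 0 = 1 := by simp [theta]

theorem norm_theta (hp : p ≠ 0) (s : ℕ) : ‖theta p s‖ = 1 :=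
  Complex.norm_eq_one_of_pow_eq_one (theta_pow_card hp s) hp

theorem conj_theta_mul_theta (hp : p ≠ 0) (s : ℕ) : conj (theta p s) * theta p s = 1 := by
  rw [Complex.conj_mul', norm_theta hp]
  simp

theorem sum_pow_eq_zero {x : ℂ} (h1 : x ^ p = 1) (hx : x ≠ 1) : ∑ j : Fin p, x ^ (j : ℕ) = 0 := by
  have h := geom_sum_mul x p
  rw [h1, sub_self] at h
  rw [Fin.sum_univ_eq_sum_range (fun j => x ^ j)]
  exact (mul_eq_zero.1 h).resolve_right (sub_ne_zero.2 hx)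

theorem sum_conj_theta_mul_theta (hp : p ≠ 0) {s s' : ℕ} (hs : s < p) (hs' : s' < p) :
    ∑ j : Fin p, conj (theta p s ^ (j : ℕ)) * theta p s' ^ (j : ℕ) = if s = s' then (p : ℂ) else 0 := by
  simp only [map_pow, ← mul_pow]
  split_ifs with h
  · subst h
    simp [conj_theta_mul_theta hp]
  · apply sum_pow_eq_zero
    · rw [mul_pow, ← map_pow, theta_pow_card hp, theta_pow_card hp]
      simp
    · intro h1
      apply h
      apply theta_injOn hp hs hs'
      calc theta p s = theta p s * (conj (theta p s) * theta p s') := by rw [h1, mul_one]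
        _ = (conj (theta p s) * theta p s) * theta p s' := by ring
        _ = theta p s' := by rw [conj_theta_mul_theta hp, one_mul]

theorem sum_theta_pow (hp : p ≠ 0) {s : ℕ} (h1 : 1 ≤ s) (hs : s < p) :
    ∑ j : Fin p, theta p s ^ (j : ℕ) = 0 := by
  have := sum_conj_theta_mul_theta hp (s := 0) (s' := s) (Nat.pos_of_ne_zero hp) hs
  rw [if_neg (by omega)] at this
  simpa [theta_zero] using this

theorem sum_conj_theta_pow (hp : p ≠ 0) {s : ℕ} (h1 : 1 ≤ s) (hs : s < p) :
    ∑ j : Fin p, conj (theta p s ^ (j : ℕ)) = 0 := by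
  rw [← map_sum, sum_theta_pow hp h1 hs, map_zero]

/-- The discrete Fourier matrix is a Vandermonde matrix with distinct nodes `conj (theta p j)`,
because `θ_s^j = θ_j^s`. -/
theorem eq_zero_of_forall_fourier_eq_zero (hp : p ≠ 0) {y : Fin p → ℂ}
    (h : ∀ s < p, ∑ j : Fin p, conj (theta p s ^ (j : ℕ)) * y j = 0) : y = 0 := by
  refine Matrix.eq_zero_of_forall_pow_sum_mul_pow_eq_zero (f := fun j : Fin p => conj (theta p j))
    (fun i j hij => Fin.ext (theta_injOn hp i.2 j.2 ((starRingEnd ℂ).injective hij))) fun s => ?_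
  rw [← h s s.2]
  refine Finset.sum_congr rfl fun j _ => ?_
  rw [theta_eq_pow, theta_eq_pow, map_pow, map_pow, map_pow, ← pow_mul, ← pow_mul, mul_comm,
    mul_comm (j : ℕ)]

/-! ### The derivatives of the basis functions -/

/-- The value of `|x| ↦ U_z 1` on the edges. -/
def branch : TraceIndex p → Edge p → ℂ
  | .rad, _ => 1
  | .node e₀ s, e =>
    if e₀.1 < e.1 ∧ (e.2 : ℕ) / p ^ (e.1 - e₀.1) = e₀.2 then
      theta p s ^ (((e.2 : ℕ) / p ^ (e.1 - e₀.1 - 1)) % p)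
    else 0

/-- The first generation on which the basis function does not vanish. -/
def startGen : TraceIndex p → ℕ
  | .rad => 0
  | .node e _ => e.1 + 1

/-- The normalizing factor of the basis function. -/
def amplitude (ℓ α : ℝ) : TraceIndex p → ℝ
  | .rad => √(1 - ℓ / (α * p))
  | .node e _ => (p : ℝ) ^ e.1 * (α / ℓ) ^ ((e.1 : ℝ) / 2) * √((α * p - ℓ) / ℓ)

/-- The derivative of the basis function. -/
def slope (ℓ α : ℝ) (z : TraceIndex p) (e : Edge p) : ℂ :=
  branch z e * (amplitude ℓ α z / (α * p) ^ e.1 : ℝ)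

theorem branch_eq_zero {z : TraceIndex p} {e : Edge p} (h : e.1 < startGen z) : branch z e = 0 := by
  cases z with
  | rad => exact absurd h (Nat.not_lt_zero _)
  | node e₀ s => exact if_neg fun h' => by simp only [startGen] at h; omega

theorem child_div (n : ℕ) (k : Fin (p ^ n)) (j : Fin p) (m : ℕ) :
    (child k j : ℕ) / p ^ (m + 1) = (k : ℕ) / p ^ m := by
  have h : ∀ x : ℕ, x / p ^ (m + 1) = x / p / p ^ m := fun x => by
    rw [pow_succ', ← Nat.div_div_eq_div_mul]
  rw [h]
  exact congrArg (fun k' : Fin (p ^ n) => (k' : ℕ) / p ^ m) (parent_child k j)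

theorem branch_child {z : TraceIndex p} {n : ℕ} (h : startGen z ≤ n) (k : Fin (p ^ n)) (j : Fin p) :
    branch z ⟨n + 1, child k j⟩ = branch z ⟨n, k⟩ := by
  cases z with
  | rad => rfl
  | node e₀ s =>
    obtain ⟨d, hd⟩ : ∃ d, n - e₀.1 = d + 1 := ⟨n - e₀.1 - 1, by simp only [startGen] at h; omega⟩
    have h1 : n + 1 - e₀.1 = d + 1 + 1 := by omega
    have h3 : e₀.1 < n + 1 := by omega
    have h4 : e₀.1 < n := by omega
    simp only [branch, h1, hd, Nat.add_sub_cancel, child_div, h3, h4]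

theorem branch_node_child (n : ℕ) (k₀ k : Fin (p ^ n)) (s : Set.Icc 1 (p - 1)) (j : Fin p) :
    branch (.node ⟨n, k₀⟩ s) ⟨n + 1, child k j⟩ = if k = k₀ then theta p s ^ (j : ℕ) else 0 := by
  have h1 : (child k j : ℕ) / p ^ 1 = k := by simpa using child_div n k j 0
  have h2 : n + 1 - n = 1 := by omega
  have h3 : (child k j : ℕ) % p = j := by rw [child_val, Nat.mul_add_mod, Nat.mod_eq_of_lt j.2]
  simp only [branch, h2, h1, Nat.sub_self, pow_zero, Nat.div_one, h3, Fin.val_inj]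
  simp

theorem norm_branch_le (hp : p ≠ 0) (z : TraceIndex p) (e : Edge p) : ‖branch z e‖ ≤ 1 := by
  cases z with
  | rad => simp [branch]
  | node e₀ s =>
    simp only [branch]
    split_ifs
    · simp [norm_theta hp]
    · simp

theorem Admissible.p_ne_zero (h : Admissible p ℓ α) : p ≠ 0 := by have := h.two_le; omega

theorem Admissible.p_pos (h : Admissible p ℓ α) : (0 : ℝ) < p := by
  exact_mod_cast Nat.pos_of_ne_zero h.p_ne_zero

theorem Admissible.αp_pos (h : Admissible p ℓ α) : 0 < α * p := mul_pos h.α_pos h.p_pos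

theorem Admissible.ratio_pos (h : Admissible p ℓ α) : 0 < ℓ / (α * p) := div_pos h.l_pos h.αp_pos

theorem Admissible.ratio_lt_one (h : Admissible p ℓ α) : ℓ / (α * p) < 1 :=
  (div_lt_one h.αp_pos).2 h.l_lt

theorem one_le_of_mem (s : Set.Icc 1 (p - 1)) : 1 ≤ (s : ℕ) := s.2.1

theorem lt_of_mem (hp : p ≠ 0) (s : Set.Icc 1 (p - 1)) : (s : ℕ) < p := by
  have := s.2.2
  omega

/-- Past the first generation of the support, the `p` children share the value of their parent
divided by `αp`. At that generation, for an index other than `rad`, the values on siblings are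
proportional to the powers of `θ_s ≠ 1`, which sum to zero. Before it both sides vanish. -/
theorem isKirchhoff_slope (h : Admissible p ℓ α) (z : TraceIndex p) :
    IsKirchhoff α (slope ℓ α z) := by
  have hα : (α : ℂ) ≠ 0 := by exact_mod_cast h.α_pos.ne'
  have hp : (p : ℂ) ≠ 0 := by exact_mod_cast h.p_ne_zero
  intro n k
  simp only [slope]
  rw [← Finset.sum_mul]
  rcases lt_trichotomy (startGen z) (n + 1) with hz | hz | hz
  · simp only [branch_child (Nat.lt_succ_iff.1 hz), Finset.sum_const, Finset.card_univ,
      Fintype.card_fin, nsmul_eq_mul]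
    push_cast
    rw [pow_succ]
    field_simp
  · rw [branch_eq_zero (e := ⟨n, k⟩) (by simp only; omega)]
    cases z with
    | rad => exact absurd hz (Nat.succ_ne_zero n).symm
    | node e₀ s =>
      obtain ⟨m, k₀⟩ := e₀
      obtain rfl : m = n := by simpa [startGen] using hz
      simp only [branch_node_child]
      split_ifs
      · rw [sum_theta_pow h.p_ne_zero (one_le_of_mem s) (lt_of_mem h.p_ne_zero s)]
        simp
      · simp
  · rw [branch_eq_zero (e := ⟨n, k⟩) (by simp only; omega)]
    simp [branch_eq_zero (z := z) (e := ⟨n + 1, child k _⟩) hz]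

/-- Generation `n` carries energy at most `A² (ℓ/(αp))^n`, with `A` the amplitude; this is where `ℓ
< αp` is needed. -/
theorem memℓp_slope (h : Admissible p ℓ α) (z : TraceIndex p) :
    Memℓp (fun e : Edge p => Lp.const 2 (edgeMeasure ℓ α e.1) (slope ℓ α z e)) 2 := by
  have hα := h.α_pos
  have hℓ := h.l_pos
  have hp := h.p_pos
  refine memℓp_const h (C := amplitude ℓ α z ^ 2 * (1 - ℓ / (α * p))⁻¹) fun N => ?_
  refine le_trans (Finset.sum_le_sum (g := fun n => amplitude ℓ α z ^ 2 * (ℓ / (α * p)) ^ n)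
    fun n _ => ?_) ?_
  · calc ∑ k : Fin (p ^ n), (α * ℓ) ^ n * ‖slope ℓ α z ⟨n, k⟩‖ ^ 2
        ≤ ∑ k : Fin (p ^ n), (α * ℓ) ^ n * (amplitude ℓ α z / (α * p) ^ n) ^ 2 := by
          refine Finset.sum_le_sum fun k _ => mul_le_mul_of_nonneg_left ?_ (by positivity)
          rw [slope, norm_mul, mul_pow, Complex.norm_real, Real.norm_eq_abs, sq_abs]
          refine mul_le_of_le_one_left (sq_nonneg _) ?_
          exact pow_le_one₀ (norm_nonneg _) (norm_branch_le h.p_ne_zero _ _)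
      _ = amplitude ℓ α z ^ 2 * (ℓ / (α * p)) ^ n := by
          simp only [Finset.sum_const, Finset.card_univ, Fintype.card_fin, nsmul_eq_mul]
          push_cast
          simp only [mul_pow, div_pow]
          field_simp
  · rw [← Finset.mul_sum]
    gcongr
    exact geom_sum_le h.ratio_pos.le h.ratio_lt_one N

/-! ### Orthonormality and completeness of the derivatives of the basis functions. -/

/-- The derivative of the basis function, as an element of `L²`. -/
def slopeFn (h : Admissible p ℓ α) (z : TraceIndex p) : TreeL2 p ℓ α := stepFn (memℓp_slope h z)

/-- The coefficient of a Kirchhoff step function with respect to a basis function, up to a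
positive factor. -/
def coeffAt (α : ℝ) (z : TraceIndex p) (c : Edge p → ℂ) (n : ℕ) : ℂ :=
  (α : ℂ) ^ n * ∑ k, conj (branch z ⟨n, k⟩) * c ⟨n, k⟩

/-- From `startGen z` on, `branch z` is inherited by the children, so the coefficient is a flux
weighted by a constant on each branch and is conserved. -/
theorem IsKirchhoff.coeffAt_add {c : Edge p → ℂ} (hK : IsKirchhoff α c) (z : TraceIndex p) (d : ℕ) :
    coeffAt α z c (d + startGen z) = coeffAt α z c (startGen z) := by
  induction d with
  | zero => simp
  | succ d ih =>
    rw [← ih, Nat.add_right_comm]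
    simp only [coeffAt]
    rw [sum_children, pow_succ, mul_assoc, Finset.mul_sum]
    congr 1
    refine Finset.sum_congr rfl fun k _ => ?_
    simp only [branch_child (Nat.le_add_left (startGen z) d)]
    rw [← Finset.mul_sum, ← hK]
    ring

/-- By `IsKirchhoff.coeffAt_add` all generations from `startGen z` on contribute the same
coefficient times a power of `ℓ/(αp)`, which leaves a geometric series. The resulting factor is also
the limit of the profile, see `profileLimit_eq`. -/
theorem inner_slopeFn_stepFn (h : Admissible p ℓ α) (z : TraceIndex p) {c : Edge p → ℂ}
    (hK : IsKirchhoff α c)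
    (hc : Memℓp (fun e : Edge p => Lp.const 2 (edgeMeasure ℓ α e.1) (c e)) 2) :
    inner ℂ (slopeFn h z) (stepFn hc) =
      (amplitude ℓ α z * ((ℓ / (α * p)) ^ startGen z / (1 - ℓ / (α * p))) : ℝ) *
        coeffAt α z c (startGen z) := by
  have h1 := hasSum_inner_stepFn h (memℓp_slope h z) (stepFn hc)
  simp only [edgeIntegral_stepFn h] at h1
  have hα : (α : ℂ) ≠ 0 := by exact_mod_cast h.α_pos.ne'
  have hp : (p : ℂ) ≠ 0 := by exact_mod_cast h.p_ne_zero
  have hterm : ∀ n, ∑ k, conj (slope ℓ α z ⟨n, k⟩) * (α : ℂ) ^ n * ((ℓ : ℂ) ^ n * c ⟨n, k⟩) =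
      (amplitude ℓ α z * (ℓ / (α * p)) ^ n : ℝ) * coeffAt α z c n := by
    intro n
    rw [coeffAt, Finset.mul_sum, Finset.mul_sum]
    refine Finset.sum_congr rfl fun k _ => ?_
    simp only [slope, map_mul, Complex.conj_ofReal, div_pow]
    push_cast
    field_simp
  simp only [hterm] at h1
  refine h1.unique ?_
  rw [← hasSum_nat_add_iff' (startGen z)]
  have hz : ∑ n ∈ Finset.range (startGen z),
      ((amplitude ℓ α z * (ℓ / (α * p)) ^ n : ℝ) : ℂ) * coeffAt α z c n = 0 := by
    refine Finset.sum_eq_zero fun n hn => ?_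
    have : coeffAt α z c n = 0 := by
      rw [coeffAt, Finset.sum_eq_zero, mul_zero]
      intro k _
      rw [branch_eq_zero (e := ⟨n, k⟩) (Finset.mem_range.1 hn)]
      simp
    rw [this, mul_zero]
  rw [hz, sub_zero]
  simp only [hK.coeffAt_add]
  refine HasSum.mul_right _ ?_
  rw [Complex.hasSum_ofReal]
  refine HasSum.mul_left _ ?_
  simp only [pow_add]
  have hgeo := (hasSum_geometric_of_lt_one h.ratio_pos.le h.ratio_lt_one).mul_right
    ((ℓ / (α * p)) ^ startGen z)
  rwa [inv_mul_eq_div] at hgeo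

theorem coeffAt_rad (c : Edge p → ℂ) : coeffAt α .rad c 0 = c (rootEdge p) := by
  simpa [coeffAt, branch] using sum_root c

theorem coeffAt_node (c : Edge p → ℂ) (n : ℕ) (k₀ : Fin (p ^ n)) (s : Set.Icc 1 (p - 1)) :
    coeffAt α (.node ⟨n, k₀⟩ s) c (n + 1) =
      (α : ℂ) ^ (n + 1) * ∑ j : Fin p, conj (theta p s ^ (j : ℕ)) * c ⟨n + 1, child k₀ j⟩ := by
  rw [coeffAt, sum_children]
  simp only [branch_node_child]
  rw [Finset.sum_eq_single k₀ (fun k _ hk => by simp [hk]) (fun hk => absurd (Finset.mem_univ _) hk)]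
  simp

theorem amplitude_pos (h : Admissible p ℓ α) (z : TraceIndex p) : 0 < amplitude ℓ α z := by
  have hα := h.α_pos
  have hℓ := h.l_pos
  have hp := h.p_pos
  cases z with
  | rad =>
    have := h.ratio_lt_one
    exact Real.sqrt_pos.2 (by linarith)
  | node e s =>
    have : 0 < (α * p - ℓ) / ℓ := div_pos (by linarith [h.l_lt]) hℓ
    simp only [amplitude]
    positivity

theorem amplitude_node_sq (h : Admissible p ℓ α) (e : Edge p) (s : Set.Icc 1 (p - 1)) :
    amplitude ℓ α (.node e s) ^ 2 =
      ((p : ℝ) ^ e.1) ^ 2 * (α / ℓ) ^ e.1 * ((α * p - ℓ) / ℓ) := by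
  have hα := h.α_pos
  have hℓ := h.l_pos
  have h1 : 0 ≤ (α * p - ℓ) / ℓ := div_nonneg (by linarith [h.l_lt]) hℓ.le
  have h2 : ((α / ℓ) ^ ((e.1 : ℝ) / 2)) ^ 2 = (α / ℓ) ^ e.1 := by
    rw [← Real.rpow_natCast _ 2, ← Real.rpow_mul (by positivity), ← Real.rpow_natCast]
    congr 1
    push_cast
    ring
  rw [amplitude, mul_pow, mul_pow, Real.sq_sqrt h1, h2]

theorem coeffAt_rad_node (e : Edge p) (s : Set.Icc 1 (p - 1)) :
    coeffAt α .rad (slope ℓ α (.node e s)) 0 = 0 := by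
  rw [coeffAt_rad, slope, branch_eq_zero (by simp [rootEdge, startGen]), zero_mul]

/-- A basis function that starts earlier has the same slope on all children of an edge, and a
constant is orthogonal to the nontrivial characters. -/
theorem coeffAt_node_of_startGen_le (h : Admissible p ℓ α) {n : ℕ} (k₀ : Fin (p ^ n))
    (s : Set.Icc 1 (p - 1)) {z : TraceIndex p} (hz : startGen z ≤ n) :
    coeffAt α (.node ⟨n, k₀⟩ s) (slope ℓ α z) (n + 1) = 0 := by
  rw [coeffAt_node]
  simp only [slope, branch_child hz]
  rw [← Finset.sum_mul, sum_conj_theta_pow h.p_ne_zero (one_le_of_mem s) (lt_of_mem h.p_ne_zero s)]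
  simp

/-- If the second function starts earlier, it is constant across siblings; if it starts later, it
vanishes in the generation considered; in the same generation, distinct edges give disjoint supports
and a common edge gives orthogonality of characters. -/
theorem coeffAt_node_node [DecidableEq (TraceIndex p)] (h : Admissible p ℓ α) (e e' : Edge p) (s s' : Set.Icc 1 (p - 1)) :
    coeffAt α (.node e s) (slope ℓ α (.node e' s')) (e.1 + 1) =
      if (TraceIndex.node e s) = .node e' s' then
        ((α ^ (e.1 + 1) * p * (amplitude ℓ α (.node e s) / (α * p) ^ (e.1 + 1)) : ℝ) : ℂ)
      else 0 := by
  obtain ⟨n, k⟩ := e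
  obtain ⟨n', k'⟩ := e'
  rcases lt_trichotomy n' n with hn | hn | hn
  · rw [coeffAt_node_of_startGen_le h k s (z := .node ⟨n', k'⟩ s') hn, if_neg]
    intro heq
    injection heq with h1
    exact hn.ne (congrArg Sigma.fst h1).symm
  · subst hn
    rw [coeffAt_node]
    simp only [slope, branch_node_child]
    by_cases hk : k = k'
    · subst hk
      simp only [if_true]
      have hs := sum_conj_theta_mul_theta h.p_ne_zero (lt_of_mem h.p_ne_zero s)
        (lt_of_mem h.p_ne_zero s')
      simp only [← mul_assoc]
      rw [← Finset.sum_mul, hs]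
      by_cases hss : s = s'
      · subst hss
        simp only [if_true]
        push_cast
        ring
      · have h1 : (s : ℕ) ≠ s' := fun h' => hss (Subtype.ext h')
        rw [if_neg h1, if_neg fun heq : TraceIndex.node _ _ = .node _ _ => hss (by injection heq)]
        simp
    · rw [if_neg]
      · simp [hk]
      · intro heq
        injection heq with h1
        exact hk (eq_of_heq (Sigma.mk.inj h1).2)
  · rw [coeffAt_node, if_neg]
    · rw [Finset.sum_eq_zero, mul_zero]
      intro j _
      rw [slope, branch_eq_zero (by simp only [startGen]; omega)]
      simp
    · intro heq
      injection heq with h1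
      exact hn.ne (congrArg Sigma.fst h1)

theorem inner_slopeFn (h : Admissible p ℓ α) (z z' : TraceIndex p) :
    inner ℂ (slopeFn h z) (slopeFn h z') =
      (amplitude ℓ α z * ((ℓ / (α * p)) ^ startGen z / (1 - ℓ / (α * p))) : ℝ) *
        coeffAt α z (slope ℓ α z') (startGen z) :=
  inner_slopeFn_stepFn h z (isKirchhoff_slope h z') (memℓp_slope h z')

/-- Orthogonality is the vanishing of `coeffAt`. The diagonal entries are `1` because the amplitudes
compensate the geometric series. -/
theorem orthonormal_slopeFn (h : Admissible p ℓ α) : Orthonormal ℂ (slopeFn h) := by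
  classical
  have hα := h.α_pos
  have hℓ := h.l_pos
  have hp := h.p_pos
  have hq := h.ratio_lt_one
  have hl := h.l_lt
  rw [orthonormal_iff_ite]
  have hrad : ∀ e s, inner ℂ (slopeFn h .rad) (slopeFn h (.node e s)) = 0 := fun e s => by
    rw [inner_slopeFn]
    simp only [startGen]
    rw [coeffAt_rad_node, mul_zero]
  rintro (_ | ⟨e, s⟩) (_ | ⟨e', s'⟩)
  · rw [inner_slopeFn, if_pos rfl]
    simp only [startGen]
    rw [coeffAt_rad]
    simp only [slope, branch, rootEdge, pow_zero, div_one, one_mul]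
    rw [← Complex.ofReal_mul]
    have h1 : amplitude ℓ α (.rad : TraceIndex p) ^ 2 = 1 - ℓ / (α * p) :=
      Real.sq_sqrt (by linarith)
    rw [← Complex.ofReal_one, Complex.ofReal_inj]
    have h2 : 1 - ℓ / (α * p) ≠ 0 := by linarith
    calc _ = amplitude ℓ α (.rad : TraceIndex p) ^ 2 / (1 - ℓ / (α * p)) := by ring
      _ = 1 := by rw [h1, div_self h2]
  · rw [hrad, if_neg (by simp)]
  · rw [if_neg (by simp), ← inner_conj_symm, hrad, map_zero]
  · rw [inner_slopeFn]
    simp only [startGen]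
    rw [coeffAt_node_node h]
    split_ifs with heq
    · rw [← Complex.ofReal_mul, ← Complex.ofReal_one, Complex.ofReal_inj]
      have h1 := amplitude_node_sq h e s
      have h2 : α * p - ℓ ≠ 0 := by linarith
      have h3 : 1 - ℓ / (α * p) = (α * p - ℓ) / (α * p) := by field_simp
      calc _ = amplitude ℓ α (.node e s) ^ 2 * ((ℓ / (α * p)) ^ (e.1 + 1) / (1 - ℓ / (α * p)) *
            (α ^ (e.1 + 1) * p / (α * p) ^ (e.1 + 1))) := by ring
        _ = 1 := by
          rw [h1, h3]
          simp only [div_pow, mul_pow, pow_succ]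
          field_simp
    · simp

/-- A Kirchhoff step function that is orthogonal to all basis functions vanishes. -/
theorem IsKirchhoff.eq_zero_of_inner_eq_zero (h : Admissible p ℓ α) {c : Edge p → ℂ}
    (hK : IsKirchhoff α c)
    (hc : Memℓp (fun e : Edge p => Lp.const 2 (edgeMeasure ℓ α e.1) (c e)) 2)
    (horth : ∀ z, inner ℂ (slopeFn h z) (stepFn hc) = 0) : c = 0 := by
  have hα : (α : ℂ) ≠ 0 := by exact_mod_cast h.α_pos.ne'
  have hcoef : ∀ z, coeffAt α z c (startGen z) = 0 := by
    intro z
    have h1 := horth z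
    rw [inner_slopeFn_stepFn h z hK hc] at h1
    refine (mul_eq_zero.1 h1).resolve_left ?_
    refine Complex.ofReal_ne_zero.2 (ne_of_gt ?_)
    have h2 := h.ratio_lt_one
    have h3 : 0 < 1 - ℓ / (α * p) := by linarith
    exact mul_pos (amplitude_pos h z) (div_pos (pow_pos h.ratio_pos _) h3)
  -- Once `c` vanishes on an edge, Kirchhoff's condition kills the Fourier coefficient `s = 0` of
  -- its values on the children, and orthogonality to the basis functions at that edge kills those
  -- with `s ≥ 1`.
  have key : ∀ (n : ℕ) (k : Fin (p ^ n)), c ⟨n, k⟩ = 0 := by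
    intro n
    induction n with
    | zero =>
      intro k
      rw [edge_zero_eq k, ← coeffAt_rad (α := α) c]
      exact hcoef .rad
    | succ n ih =>
      intro k
      obtain ⟨i, j, rfl⟩ := exists_child_eq k
      refine congrFun (eq_zero_of_forall_fourier_eq_zero h.p_ne_zero
        (y := fun j => c ⟨n + 1, child i j⟩) fun s hs => ?_) j
      rcases Nat.eq_zero_or_pos s with rfl | hs0
      · have h1 := hK n i
        rw [ih i] at h1
        simpa [theta_zero] using (mul_eq_zero.1 h1).resolve_left hα
      · have h1 := hcoef (.node ⟨n, i⟩ ⟨s, hs0, by omega⟩)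
        simp only [startGen] at h1
        rw [coeffAt_node] at h1
        exact (mul_eq_zero.1 h1).resolve_left (pow_ne_zero _ hα)
  ext ⟨n, k⟩
  exact key n k

/-! ### The basis functions -/

theorem ancestorSum_slope (h : Admissible p ℓ α) (z : TraceIndex p) (n : ℕ) (k : Fin (p ^ n)) :
    ancestorSum (edgeIntegral (slopeFn h z)) n k =
      branch z ⟨n, k⟩ * (amplitude ℓ α z *
        ∑ i ∈ Finset.Ico (startGen z) n, (ℓ / (α * p)) ^ i : ℝ) := by
  induction n with
  | zero => simp [ancestorSum]
  | succ n ih =>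
    obtain ⟨i, j, rfl⟩ := exists_child_eq k
    rw [ancestorSum_child, ih i, slopeFn, edgeIntegral_stepFn h, slope]
    rcases lt_or_ge n (startGen z) with hz | hz
    · rw [branch_eq_zero (e := ⟨n, i⟩) hz,
        Finset.Ico_eq_empty_of_le (show n + 1 ≤ startGen z by omega)]
      simp
    · rw [branch_child hz, Finset.sum_Ico_succ_top hz]
      push_cast
      rw [div_pow]
      ring

theorem levelStart_mono (h : Admissible p ℓ α) : Monotone (levelStart ℓ) :=
  monotone_nat_of_le_succ fun n => (levelStart_lt_succ h.l_pos n).le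

theorem gen_eq (h : Admissible p ℓ α) {n : ℕ} {t : ℝ}
    (ht : t ∈ Ioc (levelStart ℓ n) (levelStart ℓ (n + 1))) : gen ℓ t = n := by
  refine le_antisymm (Nat.sInf_le ht.2) (le_csInf ⟨n, ht.2⟩ fun m hm => ?_)
  by_contra hlt
  have := levelStart_mono h (not_le.1 hlt : m + 1 ≤ n)
  exact absurd ht.1 (not_lt.2 (le_trans hm this))

theorem basisFun_eq (z : TraceIndex p) (e : Edge p) (t : ℝ) :
    basisFun ℓ α z e t = branch z e * (profile ℓ α z t : ℝ) := by
  cases z with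
  | rad => simp [basisFun, liftRad, branch, profile]
  | node e₀ s =>
    simp only [basisFun, liftNode, branch, profile]
    split_ifs <;> simp

theorem profile_eq (z : TraceIndex p) (t : ℝ) :
    profile ℓ α z t = amplitude ℓ α z * ((t - levelStart ℓ (gen ℓ t)) / (α * p) ^ gen ℓ t +
      ∑ i ∈ Finset.Ico (startGen z) (gen ℓ t), (ℓ / (α * p)) ^ i) := by
  cases z with
  | rad => simp only [profile, radProfile, amplitude, startGen, Nat.Ico_zero_eq_range]
  | node e₀ s => rfl

/-- This identifies `φ_z` with the primitive of the step function `slopeFn h z`, so computations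
with `φ_z` reduce to its slopes. -/
theorem represents_basisFun (h : Admissible p ℓ α) (z : TraceIndex p) :
    Represents (primitive h (slopeFn h z)).fn (basisFun ℓ α z) := by
  intro e
  filter_upwards [represents_primitive h (slopeFn h z) e, ae_mem_Ioo h e.1] with t h1 h2
  have h3 : pathIntegral (slopeFn h z) e t = _ :=
    pathIntegral_stepFn h (memℓp_slope h z) e (Ioo_subset_Icc_self h2)
  have h4 := ancestorSum_slope h z e.1 e.2
  rw [slopeFn] at h4
  rw [h1, h3, basisFun_eq, profile_eq, gen_eq h ⟨h2.1, h2.2.le⟩, h4, slope]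
  push_cast
  ring

/-! ### The limits of the profiles and the weights -/

theorem tendsto_levelStart (h : Admissible p ℓ α) : Tendsto (levelStart ℓ) atTop (𝓝 (height ℓ)) :=
  (summable_geometric_of_lt_one h.l_pos.le h.l_lt_one).hasSum.tendsto_sum_nat

theorem levelStart_lt_height (h : Admissible p ℓ α) (n : ℕ) : levelStart ℓ n < height ℓ :=
  (levelStart_lt_succ h.l_pos n).trans_le ((levelStart_mono h).ge_of_tendsto (tendsto_levelStart h) _)

theorem mem_Ioc_gen (h : Admissible p ℓ α) {t : ℝ} (h0 : 0 < t) (ht : t < height ℓ) :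
    t ∈ Ioc (levelStart ℓ (gen ℓ t)) (levelStart ℓ (gen ℓ t + 1)) := by
  have hne : {n : ℕ | t ≤ levelStart ℓ (n + 1)}.Nonempty := by
    obtain ⟨n, hn⟩ := ((tendsto_levelStart h).eventually (lt_mem_nhds ht)).exists
    exact ⟨n, hn.le.trans (levelStart_lt_succ h.l_pos n).le⟩
  have h1 : t ≤ levelStart ℓ (gen ℓ t + 1) := Nat.sInf_mem hne
  refine ⟨?_, h1⟩
  by_contra hn
  rw [not_lt] at hn
  rcases Nat.eq_zero_or_pos (gen ℓ t) with hg | hg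
  · rw [hg, levelStart_zero] at hn
    linarith
  · obtain ⟨m, hm⟩ := Nat.exists_eq_succ_of_ne_zero hg.ne'
    have h2 : gen ℓ t ≤ m := Nat.sInf_le (by rw [hm] at hn; exact hn)
    omega

theorem tendsto_gen (h : Admissible p ℓ α) : Tendsto (gen ℓ) (𝓝[<] (height ℓ)) atTop := by
  rw [tendsto_atTop]
  intro n
  filter_upwards [Ioo_mem_nhdsLT (levelStart_lt_height h n)] with t ht
  have h0 : 0 < t := by
    refine lt_of_le_of_lt ?_ ht.1
    rw [← levelStart_zero ℓ]
    exact levelStart_mono h (Nat.zero_le n)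
  have h1 := mem_Ioc_gen h h0 ht.2
  by_contra hn
  have := levelStart_mono h (not_le.1 hn : gen ℓ t + 1 ≤ n)
  linarith [h1.2, ht.1]

/-- As `t` tends to `L` the generation tends to infinity. The affine term on the current edge is at
most `(ℓ/(αp))^gen`, and the sum becomes the tail of a geometric series. -/
theorem tendsto_profile (h : Admissible p ℓ α) (z : TraceIndex p) :
    Tendsto (profile ℓ α z) (𝓝[<] (height ℓ))
      (𝓝 (amplitude ℓ α z * ((ℓ / (α * p)) ^ startGen z / (1 - ℓ / (α * p))))) := by
  have hq0 := h.ratio_pos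
  have hq1 := h.ratio_lt_one
  have hgeo : Tendsto (fun n => ∑ i ∈ Finset.Ico (startGen z) n, (ℓ / (α * p)) ^ i) atTop
      (𝓝 ((ℓ / (α * p)) ^ startGen z / (1 - ℓ / (α * p)))) := by
    have h1 := ((hasSum_geometric_of_lt_one hq0.le hq1).mul_left
      ((ℓ / (α * p)) ^ startGen z)).tendsto_sum_nat
    rw [← div_eq_mul_inv] at h1
    rw [← tendsto_add_atTop_iff_nat (startGen z)]
    convert h1 using 2 with n
    rw [Finset.sum_Ico_eq_sum_range, Nat.add_sub_cancel]
    simp only [pow_add]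
  have hfirst : Tendsto (fun t => (t - levelStart ℓ (gen ℓ t)) / (α * p) ^ gen ℓ t)
      (𝓝[<] (height ℓ)) (𝓝 0) := by
    refine squeeze_zero' (g := fun t => (ℓ / (α * p)) ^ gen ℓ t) ?_ ?_
      ((tendsto_pow_atTop_nhds_zero_of_lt_one hq0.le hq1).comp (tendsto_gen h))
    all_goals
      have hh : (0 : ℝ) < height ℓ := levelStart_zero ℓ ▸ levelStart_lt_height h 0
      filter_upwards [Ioo_mem_nhdsLT hh] with t ht
      have h1 := mem_Ioc_gen h ht.1 ht.2
      have h2 := pow_pos h.αp_pos (gen ℓ t)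
    · exact div_nonneg (by linarith [h1.1]) h2.le
    · rw [div_pow]
      have h3 := h1.2
      rw [levelStart_succ] at h3
      gcongr
      linarith
  have := (hfirst.add (hgeo.comp (tendsto_gen h))).const_mul (amplitude ℓ α z)
  rw [zero_add] at this
  exact this.congr fun t => (profile_eq z t).symm

theorem profileLimit_eq (h : Admissible p ℓ α) (z : TraceIndex p) :
    profileLimit ℓ α z = amplitude ℓ α z * ((ℓ / (α * p)) ^ startGen z / (1 - ℓ / (α * p))) :=
  (tendsto_profile h z).limUnder_eq

theorem multCoeff_pos (h : Admissible p ℓ α) (z : TraceIndex p) : 0 < multCoeff ℓ α z := by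
  rw [multCoeff, profileLimit_eq h]
  have h3 : 0 < 1 - ℓ / (α * p) := by linarith [h.ratio_lt_one]
  exact mul_pos (Real.rpow_pos_of_pos h.p_pos _)
    (mul_pos (amplitude_pos h z) (div_pos (pow_pos h.ratio_pos _) h3))

/-- The exponent `σ` is defined by `p^{2σ} = αp/ℓ`. -/
theorem weight_sigma_sq (h : Admissible p ℓ α) (e : Edge p) (s : Set.Icc 1 (p - 1)) :
    weight (sigma p ℓ α) (.node e s) ^ 2 = (α * p / ℓ) ^ e.1 := by
  have hp1 : (1 : ℝ) < p := by exact_mod_cast h.two_le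
  have hlog : Real.log p ≠ 0 := (Real.log_pos hp1).ne'
  have hpos : 0 < α * p / ℓ := div_pos h.αp_pos h.l_pos
  rw [weight, ← Real.rpow_natCast _ 2, ← Real.rpow_mul h.p_pos.le, ← Real.rpow_natCast _ e.1,
    Real.rpow_def_of_pos h.p_pos, Real.rpow_def_of_pos hpos]
  congr 1
  simp only [sigma, TraceIndex.nu]
  push_cast
  field_simp

/-- The product of the weight and the coefficient of `M` does not depend on the generation. -/
theorem weight_mul_multCoeff_node (h : Admissible p ℓ α) (e : Edge p) (s : Set.Icc 1 (p - 1)) :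
    (weight (sigma p ℓ α) (.node e s) * multCoeff ℓ α (.node e s)) ^ 2 = ℓ / (α * p - ℓ) := by
  have hα := h.α_pos
  have hℓ := h.l_pos
  have hp := h.p_pos
  have hl := h.l_lt
  have h2 : α * p - ℓ ≠ 0 := by linarith
  have h3 : 1 - ℓ / (α * p) = (α * p - ℓ) / (α * p) := by field_simp
  have h4 : ((p : ℝ) ^ (-((TraceIndex.node e s).nu : ℝ) / 2)) ^ 2 = ((p : ℝ) ^ e.1)⁻¹ := by
    rw [← Real.rpow_natCast _ 2, ← Real.rpow_mul hp.le, ← Real.rpow_natCast _ e.1,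
      ← Real.rpow_neg hp.le]
    congr 1
    simp only [TraceIndex.nu]
    push_cast
    ring
  -- The powers with exponent `n` cancel: the squared weight gives `(αp/ℓ)^n`, the factor `p^{-n}`
  -- with the squared amplitude gives `(αp/ℓ)^n` again, and the squared limit contributes
  -- `(ℓ/(αp))^{2n}`.
  rw [mul_pow, weight_sigma_sq h, multCoeff, profileLimit_eq h, mul_pow, h4, mul_pow,
    amplitude_node_sq h, h3]
  simp only [startGen, div_pow, mul_pow, pow_succ]
  field_simp

/-- The factor by which `M` multiplies the norms of the coefficients. -/
def weightedCoeff (ℓ α : ℝ) (z : TraceIndex p) : ℝ := weight (sigma p ℓ α) z * multCoeff ℓ α z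

theorem weight_sigma_pos (h : Admissible p ℓ α) (z : TraceIndex p) :
    0 < weight (sigma p ℓ α) z := Real.rpow_pos_of_pos h.p_pos _

/-- Only two values occur, one at `rad` and one at all the nodes. -/
theorem exists_weightedCoeff_bounds (h : Admissible p ℓ α) :
    ∃ a b : ℝ, 0 < a ∧ ∀ z : TraceIndex p, a ≤ weightedCoeff ℓ α z ∧ weightedCoeff ℓ α z ≤ b := by
  have hpos : ∀ z : TraceIndex p, 0 < weightedCoeff ℓ α z := fun z =>
    mul_pos (weight_sigma_pos h z) (multCoeff_pos h z)
  have hl := h.l_lt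
  have hκ : 0 < √(ℓ / (α * p - ℓ)) := Real.sqrt_pos.2 (div_pos h.l_pos (by linarith))
  have hnode : ∀ e s, weightedCoeff ℓ α (.node e s : TraceIndex p) = √(ℓ / (α * p - ℓ)) := by
    intro e s
    rw [← weight_mul_multCoeff_node h e s]
    exact (Real.sqrt_sq (hpos (.node e s)).le).symm
  refine ⟨min (weightedCoeff ℓ α (.rad : TraceIndex p)) √(ℓ / (α * p - ℓ)),
    max (weightedCoeff ℓ α (.rad : TraceIndex p)) √(ℓ / (α * p - ℓ)), lt_min (hpos _) hκ, ?_⟩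
  rintro (_ | ⟨e, s⟩)
  · exact ⟨min_le_left _ _, le_max_left _ _⟩
  · rw [hnode]
    exact ⟨min_le_right _ _, le_max_right _ _⟩

/-- The weight is at least `1` at the nodes, since `ℓ < αp`, while at `rad` it is `p^{-σ}`. The
bound yields membership in `ℓ²` from membership of the weighted sequence. -/
theorem exists_weight_bound (h : Admissible p ℓ α) :
    ∃ a : ℝ, 0 < a ∧ ∀ z : TraceIndex p, a ≤ weight (sigma p ℓ α) z := by
  refine ⟨min (weight (sigma p ℓ α) (.rad : TraceIndex p)) 1,
    lt_min (weight_sigma_pos h _) one_pos, ?_⟩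
  rintro (_ | ⟨e, s⟩)
  · exact min_le_left _ _
  · refine (min_le_right _ _).trans ?_
    have h1 : (1 : ℝ) ≤ α * p / ℓ := (one_le_div h.l_pos).2 h.l_lt.le
    have h2 := one_le_pow₀ h1 (n := e.1)
    rw [← weight_sigma_sq h e s] at h2
    exact (one_le_sq_iff₀ (weight_sigma_pos h _).le).1 h2

/-! ### Functions of compact support -/

theorem finite_setOf_generation_le (N : ℕ) : {e : Edge p | e.1 ≤ N}.Finite :=
  ((Finset.range (N + 1)).sigma fun _ => Finset.univ).finite_toSet.subset fun e he => by
    simpa [Nat.lt_succ_iff] using he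

theorem memℓp_of_generation_le {c : Edge p → ℂ} {N : ℕ} (hc : ∀ e, N < e.1 → c e = 0) :
    Memℓp (fun e : Edge p => Lp.const 2 (edgeMeasure ℓ α e.1) (c e)) 2 := by
  refine Memℓp.of_exponent_ge (memℓp_zero ((finite_setOf_generation_le N).subset fun e he => ?_))
    zero_le
  by_contra hn
  exact he (by simp only [hc e (not_le.1 hn), map_zero])

/-- The constant `c` is `0` for functions vanishing far out, and `-1` in the construction of the
cutoff. -/
theorem fn_primitive_eq_zero (h : Admissible p ℓ α) {g : TreeL2 p ℓ α} {e : Edge p} {c : ℂ}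
    (hg : g e = 0) (hsum : ancestorSum (edgeIntegral g) e.1 e.2 = c) :
    ((primitive h g).fn e : ℝ → ℂ) =ᵐ[edgeMeasure ℓ α e.1] fun _ => c := by
  have hae := (ae_edgeMeasure_iff h).1 (Lp.coeFn_zero ℂ 2 (edgeMeasure ℓ α e.1))
  filter_upwards [represents_primitive h g e, ae_mem_Ioo h e.1] with t h1 h2
  rw [h1, pathIntegral, hsum, intervalIntegral.integral_of_le h2.1.le, integral_Ioc_eq_integral_Ioo,
    setIntegral_congr_ae (g := fun _ => (0 : ℂ)) measurableSet_Ioo]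
  · simp
  · rw [hg]
    filter_upwards [hae] with s hs hs' using hs ⟨hs'.1, hs'.2.trans h2.2⟩

theorem primitive_mem_H1c (h : Admissible p ℓ α) {g : TreeL2 p ℓ α} {N : ℕ}
    (hg : ∀ e : Edge p, N < e.1 → g e = 0)
    (hsum : ∀ e : Edge p, N < e.1 → ancestorSum (edgeIntegral g) e.1 e.2 = 0) :
    primitive h g ∈ H1c p ℓ α :=
  ⟨N, fun e he => Lp.ext ((fn_primitive_eq_zero h (hg e he) (hsum e he)).trans
    (Lp.coeFn_zero _ _ _).symm)⟩

theorem H1c_le_H10 : H1c p ℓ α ≤ H10 p ℓ α := Submodule.le_topologicalClosure _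

theorem evalRoot_primitive (h : Admissible p ℓ α) (g : TreeL2 p ℓ α) :
    evalRoot h (primitive h g) = 0 := (mem_H1t_iff h).1 (primitive_mem_H1t h g)

theorem evalRoot_oneH1 (h : Admissible p ℓ α) : evalRoot h (oneH1 h) = 1 := by
  have h1 := eq_evalRoot_smul_add h (oneH1 h)
  rw [der_oneH1, map_zero, add_zero] at h1
  have h2 : (evalRoot h (oneH1 h) - 1) • oneH1 h = 0 := by
    rw [sub_smul, one_smul, ← h1, sub_self]
  exact sub_eq_zero.1 ((smul_eq_zero.1 h2).resolve_right (oneH1_ne_zero h))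

/-- There is a function of compact support with the value `1` at the root. -/
theorem exists_cutoff (h : Admissible p ℓ α) :
    ∃ χ : H1 p ℓ α, χ ∈ H1c p ℓ α ∧ evalRoot h χ = 1 := by
  -- The cutoff is `1` at the root and decreases with slope `-1` to `0` on the root edge, whose
  -- length is `ℓ^0 = 1`.
  let d : Edge p → ℂ := fun e => if e.1 = 0 then -1 else 0
  have hd0 : ∀ e : Edge p, 0 < e.1 → d e = 0 := fun e he => if_neg he.ne'
  have hd := memℓp_of_generation_le (ℓ := ℓ) (α := α) hd0
  have hsum : ∀ (n : ℕ) (k : Fin (p ^ (n + 1))),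
      ancestorSum (edgeIntegral (stepFn hd)) (n + 1) k = -1 := by
    intro n
    induction n with
    | zero => intro k; simp [ancestorSum, edgeIntegral_stepFn h, d]
    | succ n ih =>
      intro k
      rw [ancestorSum, ih, edgeIntegral_stepFn h, hd0 _ n.succ_pos, mul_zero, add_zero]
  refine ⟨oneH1 h + primitive h (stepFn hd), ⟨0, fun e he => ?_⟩, ?_⟩
  · obtain ⟨n, k⟩ := e
    obtain ⟨m, rfl⟩ := Nat.exists_eq_succ_of_ne_zero (Nat.pos_iff_ne_zero.1 he)
    have hz : stepFn hd ⟨m + 1, k⟩ = 0 := by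
      change Lp.const 2 _ (d _) = 0
      rw [hd0 _ he, map_zero]
    apply Lp.ext
    have h1 := fn_primitive_eq_zero h hz (hsum m k)
    filter_upwards [h1, represents_oneH1 h ⟨m + 1, k⟩, Lp.coeFn_zero ℂ 2 (edgeMeasure ℓ α (m + 1)),
      Lp.coeFn_add ((oneH1 h).fn ⟨m + 1, k⟩) ((primitive h (stepFn hd)).fn ⟨m + 1, k⟩)]
      with t t1 t2 t3 t4
    refine t4.trans ?_
    rw [t3, Pi.add_apply, t1, t2]
    simp
  · rw [map_add, evalRoot_oneH1, evalRoot_primitive, add_zero]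

/-! ### The orthogonal complement of the functions of compact support -/

/-- The derivatives of the functions of compact support that vanish at the root. -/
def compactDer (p : ℕ) (ℓ α : ℝ) : Submodule ℂ (TreeL2 p ℓ α) :=
  (H1t p ℓ α ⊓ H1c p ℓ α).map (derL p ℓ α).toLinearMap

theorem mem_compactDer (h : Admissible p ℓ α) {g : TreeL2 p ℓ α} {N : ℕ}
    (hg : ∀ e : Edge p, N < e.1 → g e = 0)
    (hsum : ∀ e : Edge p, N < e.1 → ancestorSum (edgeIntegral g) e.1 e.2 = 0) :
    g ∈ compactDer p ℓ α :=
  ⟨primitive h g, ⟨primitive_mem_H1t h g, primitive_mem_H1c h hg hsum⟩, rfl⟩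

/-- The continuity of `primitive` turns an `L²` closure of derivatives into the `H¹` closure that
defines `H10`. -/
theorem primitive_mem_H10 (h : Admissible p ℓ α) {g : TreeL2 p ℓ α}
    (hg : g ∈ (compactDer p ℓ α).topologicalClosure) : primitive h g ∈ H10 p ℓ α := by
  have hle : compactDer p ℓ α ≤ (H10 p ℓ α).comap (primitive h).toLinearMap := by
    rintro _ ⟨u, ⟨h1, h2⟩, rfl⟩
    change primitive h u.der ∈ H10 p ℓ α
    rw [← eq_primitive_of_mem_H1t h h1]
    exact H1c_le_H10 h2
  exact Submodule.topologicalClosure_minimal _ hle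
    ((Submodule.isClosed_topologicalClosure _).preimage (primitive h).continuous) hg

theorem ancestorSum_zero {E : Type*} [AddCommMonoid E] {c : Edge p → E} (hc : ∀ e, c e = 0) (n : ℕ)
    (k : Fin (p ^ n)) : ancestorSum c n k = 0 := by
  induction n with
  | zero => rfl
  | succ n ih => rw [ancestorSum, ih, hc, add_zero]

theorem edgeIntegral_eq_zero (h : Admissible p ℓ α) {g : TreeL2 p ℓ α} {e : Edge p} (hg : g e = 0) :
    edgeIntegral g e = 0 := by
  rw [edgeIntegral, hg]
  refine (setIntegral_congr_ae (g := fun _ => (0 : ℂ)) measurableSet_Ioo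
    ((ae_edgeMeasure_iff h).1 (Lp.coeFn_zero ℂ 2 (edgeMeasure ℓ α e.1)))).trans (by simp)

/-- The function that is `ψ` on the edge `e` and vanishes on all other edges. -/
def edgeSingle [DecidableEq (Edge p)] (e : Edge p) (ψ : Lp ℂ 2 (edgeMeasure ℓ α e.1)) :
    TreeL2 p ℓ α :=
  lp.single (E := fun e : Edge p => Lp ℂ 2 (edgeMeasure ℓ α e.1)) 2 e ψ

theorem edgeSingle_self [DecidableEq (Edge p)] (e : Edge p) (ψ : Lp ℂ 2 (edgeMeasure ℓ α e.1)) :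
    edgeSingle e ψ e = ψ :=
  lp.single_apply_self (E := fun e : Edge p => Lp ℂ 2 (edgeMeasure ℓ α e.1)) 2 e ψ

theorem edgeSingle_ne [DecidableEq (Edge p)] (e : Edge p) (ψ : Lp ℂ 2 (edgeMeasure ℓ α e.1))
    {e' : Edge p} (he : e' ≠ e) : edgeSingle e ψ e' = 0 :=
  lp.single_apply_ne (E := fun e : Edge p => Lp ℂ 2 (edgeMeasure ℓ α e.1)) 2 e ψ he

theorem inner_edgeSingle_left [DecidableEq (Edge p)] (e : Edge p)
    (ψ : Lp ℂ 2 (edgeMeasure ℓ α e.1)) (w : TreeL2 p ℓ α) :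
    inner ℂ (edgeSingle e ψ) w = inner ℂ ψ (w e) :=
  lp.inner_single_left (G := fun e : Edge p => Lp ℂ 2 (edgeMeasure ℓ α e.1)) e ψ w

theorem edgeSingle_mem_compactDer [DecidableEq (Edge p)] (h : Admissible p ℓ α) (e : Edge p)
    (ψ : Lp ℂ 2 (edgeMeasure ℓ α e.1))
    (hψ : ∫ t in Ioo (levelStart ℓ e.1) (levelStart ℓ (e.1 + 1)), ψ t = 0) :
    edgeSingle e ψ ∈ compactDer p ℓ α := by
  refine mem_compactDer h (N := e.1) (fun e' he' => edgeSingle_ne e ψ ?_)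
    fun e' _ => ancestorSum_zero (fun e' => ?_) _ _
  · rintro rfl
    exact lt_irrefl _ he'
  · by_cases he : e' = e
    · subst he
      rw [edgeIntegral, edgeSingle_self]
      exact hψ
    · exact edgeIntegral_eq_zero h (edgeSingle_ne e ψ he)

/-- Let `ψ` be `w e` minus its mean. It has mean zero, so supported on this edge alone it is the
derivative of a compactly supported function and is orthogonal to `w`. It is also orthogonal to
constants, hence to itself. -/
theorem exists_eq_const_of_orthogonal (h : Admissible p ℓ α) {w : TreeL2 p ℓ α}
    (hw : ∀ g ∈ compactDer p ℓ α, inner ℂ g w = 0) (e : Edge p) :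
    ∃ c, w e = Lp.const 2 (edgeMeasure ℓ α e.1) c := by
  classical
  set I := ∫ t in Ioo (levelStart ℓ e.1) (levelStart ℓ (e.1 + 1)), w e t with hI
  have hℓ := pow_pos h.l_pos e.1
  have hℓ' : (ℓ : ℂ) ^ e.1 ≠ 0 := by exact_mod_cast hℓ.ne'
  set c : ℂ := I / (ℓ : ℂ) ^ e.1 with hc
  set ψ := w e - Lp.const 2 (edgeMeasure ℓ α e.1) c with hψ
  have hint : ∫ t in Ioo (levelStart ℓ e.1) (levelStart ℓ (e.1 + 1)), ψ t = 0 := by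
    have h1 : ∫ t in Ioo (levelStart ℓ e.1) (levelStart ℓ (e.1 + 1)), ψ t =
        ∫ t in Ioo (levelStart ℓ e.1) (levelStart ℓ (e.1 + 1)), (w e t - c) := by
      refine setIntegral_congr_ae measurableSet_Ioo ((ae_edgeMeasure_iff h).1 ?_)
      filter_upwards [Lp.coeFn_sub (w e) (Lp.const 2 (edgeMeasure ℓ α e.1) c),
        Lp.coeFn_const 2 (edgeMeasure ℓ α e.1) c] with t t1 t2
      rw [hψ, t1, Pi.sub_apply, t2, Function.const_apply]
    rw [h1, integral_sub (integrableOn_coeFn h (w e)) (integrableOn_const (by simp)), ← hI]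
    simp [levelStart_succ, hℓ.le, hc, mul_div_cancel₀ _ hℓ']
  have h1 : inner ℂ ψ (w e) = 0 := by
    rw [← inner_edgeSingle_left]
    exact hw _ (edgeSingle_mem_compactDer h e ψ hint)
  have h2 : inner ℂ ψ (Lp.const 2 (edgeMeasure ℓ α e.1) c) = 0 := by
    rw [← inner_conj_symm, inner_const_left h, hint, mul_zero, map_zero]
  have h3 : inner ℂ ψ ψ = 0 := by
    nth_rewrite 2 [hψ]
    rw [inner_sub_right, h1, h2, sub_zero]
  exact ⟨c, sub_eq_zero.1 (inner_self_eq_zero.1 h3)⟩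

/-- The value at the initial point of an edge of the function with the values `v_e` at the end
points of the edges `e`, and the value `0` at the root. -/
def startValue (v : Edge p → ℂ) : Edge p → ℂ
  | ⟨0, _⟩ => 0
  | ⟨n + 1, k⟩ => v ⟨n, parent k⟩

/-- The derivative of the edgewise affine function with the values `v_e` at the end points of the
edges `e`. -/
def affineSlope (ℓ : ℝ) (v : Edge p → ℂ) (e : Edge p) : ℂ :=
  (v e - startValue v e) / (ℓ : ℂ) ^ e.1

theorem startValue_eq_zero {v : Edge p → ℂ} {N : ℕ} (hv : ∀ e, N < e.1 → v e = 0) {e : Edge p}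
    (he : N + 1 < e.1) : startValue v e = 0 := by
  obtain ⟨n, k⟩ := e
  cases n with
  | zero => rfl
  | succ n => exact hv _ (Nat.lt_of_succ_lt_succ he)

theorem affineSlope_eq_zero {v : Edge p → ℂ} {N : ℕ} (hv : ∀ e, N < e.1 → v e = 0) (e : Edge p)
    (he : N + 1 < e.1) : affineSlope ℓ v e = 0 := by
  rw [affineSlope, startValue_eq_zero hv he, hv e (by omega), sub_zero, zero_div]

theorem ancestorSum_affineSlope (h : Admissible p ℓ α) {v : Edge p → ℂ}
    (hd : Memℓp (fun e : Edge p => Lp.const 2 (edgeMeasure ℓ α e.1) (affineSlope ℓ v e)) 2) (n : ℕ)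
    (k : Fin (p ^ n)) : ancestorSum (edgeIntegral (stepFn hd)) n k = startValue v ⟨n, k⟩ := by
  induction n with
  | zero => rfl
  | succ n ih =>
    have hℓ : (ℓ : ℂ) ^ n ≠ 0 := pow_ne_zero _ (by exact_mod_cast h.l_pos.ne')
    rw [ancestorSum, ih, edgeIntegral_stepFn h, affineSlope, mul_div_cancel₀ _ hℓ]
    simp [startValue]

/-- The test function is the hat function at the end point of `e_{n,k}`, affine on every edge and
`0` at all other vertices. -/
theorem isKirchhoff_of_orthogonal (h : Admissible p ℓ α) {c : Edge p → ℂ}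
    (hc : Memℓp (fun e : Edge p => Lp.const 2 (edgeMeasure ℓ α e.1) (c e)) 2)
    (hw : ∀ g ∈ compactDer p ℓ α, inner ℂ g (stepFn hc) = 0) : IsKirchhoff α c := by
  classical
  intro n k
  have hα : (α : ℂ) ≠ 0 := by exact_mod_cast h.α_pos.ne'
  have hℓ : (ℓ : ℂ) ≠ 0 := by exact_mod_cast h.l_pos.ne'
  let v : Edge p → ℂ := fun e => if e = ⟨n, k⟩ then 1 else 0
  have hv : ∀ e, n < e.1 → v e = 0 := fun e he => if_neg (by rintro rfl; exact lt_irrefl _ he)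
  have hd0 := affineSlope_eq_zero (ℓ := ℓ) hv
  have hd := memℓp_of_generation_le (ℓ := ℓ) (α := α) hd0
  have hmem : stepFn hd ∈ compactDer p ℓ α := by
    refine mem_compactDer h (N := n + 1) (fun e he => ?_) fun e he => ?_
    · change Lp.const 2 _ (affineSlope ℓ v e) = 0
      rw [hd0 e he, map_zero]
    · rw [ancestorSum_affineSlope h]
      exact startValue_eq_zero hv he
  have h1 := hasSum_inner_stepFn h hd (stepFn hc)
  rw [hw _ hmem] at h1
  have hreal : ∀ e, conj (startValue v e) = startValue v e := by
    rintro ⟨_ | m, i⟩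
    · simp [startValue]
    · simp only [startValue, v]
      split_ifs <;> simp
  have hreal' : ∀ e, conj (v e) = v e := by
    intro e
    simp only [v]
    split_ifs <;> simp
  have hend : ∀ m, ∑ i, v ⟨m, i⟩ * ((α : ℂ) ^ m * c ⟨m, i⟩) =
      if m = n then (α : ℂ) ^ n * c ⟨n, k⟩ else 0 := by
    intro m
    split_ifs with hm
    · subst hm
      rw [Finset.sum_eq_single k]
      · simp [v]
      · intro i _ hi
        simp [v, hi]
      · simp
    · refine Finset.sum_eq_zero fun i _ => ?_
      have : v ⟨m, i⟩ = 0 := if_neg fun heq => hm (congrArg Sigma.fst heq)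
      rw [this, zero_mul]
  have hstart : ∀ m, ∑ i, startValue v ⟨m, i⟩ * ((α : ℂ) ^ m * c ⟨m, i⟩) =
      if m = n + 1 then (α : ℂ) ^ (n + 1) * ∑ j, c ⟨n + 1, child k j⟩ else 0 := by
    intro m
    cases m with
    | zero => simp [startValue]
    | succ m =>
      rw [sum_children]
      simp only [startValue, parent_child, Nat.succ_inj]
      split_ifs with hm
      · subst hm
        rw [Finset.sum_eq_single k]
        · simp [v, Finset.mul_sum]
        · intro i _ hi
          simp [v, hi]
        · simp
      · refine Finset.sum_eq_zero fun i _ => Finset.sum_eq_zero fun j _ => ?_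
        have : v ⟨m, i⟩ = 0 := if_neg fun heq => hm (congrArg Sigma.fst heq)
        rw [this, zero_mul]
  -- The edge length `ℓ^m` cancels the denominator of the slope. What remains is the end value minus
  -- the start value on each edge, nonzero only for `e_{n,k}` and its children.
  have hterm : ∀ m, ∑ i, conj (affineSlope ℓ v ⟨m, i⟩) * (α : ℂ) ^ m *
      edgeIntegral (stepFn hc) ⟨m, i⟩ =
      (if m = n then (α : ℂ) ^ n * c ⟨n, k⟩ else 0) -
        if m = n + 1 then (α : ℂ) ^ (n + 1) * ∑ j, c ⟨n + 1, child k j⟩ else 0 := by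
    intro m
    rw [← hend, ← hstart, ← Finset.sum_sub_distrib]
    refine Finset.sum_congr rfl fun i _ => ?_
    rw [edgeIntegral_stepFn h, affineSlope, map_div₀, map_sub, hreal, hreal', map_pow,
      Complex.conj_ofReal]
    field_simp
  simp only [hterm] at h1
  have h2 := h1.unique ((hasSum_ite_eq n _).sub (hasSum_ite_eq (n + 1) _))
  have h3 := sub_eq_zero.1 h2.symm
  rw [pow_succ, mul_assoc] at h3
  exact (mul_left_cancel₀ (pow_ne_zero _ hα) h3).symm

theorem exists_isKirchhoff_of_orthogonal (h : Admissible p ℓ α) {w : TreeL2 p ℓ α}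
    (hw : ∀ g ∈ compactDer p ℓ α, inner ℂ g w = 0) :
    ∃ (c : Edge p → ℂ) (hc : Memℓp (fun e : Edge p => Lp.const 2 (edgeMeasure ℓ α e.1) (c e)) 2),
      IsKirchhoff α c ∧ w = stepFn hc := by
  choose c hc using exists_eq_const_of_orthogonal h hw
  have hmem : Memℓp (fun e : Edge p => Lp.const 2 (edgeMeasure ℓ α e.1) (c e)) 2 := by
    have h1 : (fun e : Edge p => Lp.const 2 (edgeMeasure ℓ α e.1) (c e)) = fun e => w e :=
      funext fun e => (hc e).symm
    rw [h1]
    exact lp.memℓp w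
  have heq : w = stepFn hmem := lp.ext (funext hc)
  exact ⟨c, hmem, isKirchhoff_of_orthogonal h hmem (heq ▸ hw), heq⟩

theorem inner_slopeFn_der_eq_zero (h : Admissible p ℓ α) (z : TraceIndex p) {u : H1 p ℓ α}
    (hu : u ∈ H1t0 p ℓ α) : inner ℂ (slopeFn h z) u.der = 0 := by
  have h1 := (isKirchhoff_slope h z).inner_der_eq h (memℓp_slope h z) hu.2
  rwa [(mem_H1t_iff h).1 hu.1, mul_zero, add_zero] at h1

/-- A function in `H̃¹` that is orthogonal to all basis functions belongs to `H¹₀`. -/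
theorem mem_H10_of_inner_eq_zero (h : Admissible p ℓ α) {u : H1 p ℓ α} (hu : u ∈ H1t p ℓ α)
    (horth : ∀ z, inner ℂ (slopeFn h z) u.der = 0) : u ∈ H10 p ℓ α := by
  -- Split `u'` into a limit `a` of derivatives of compactly supported functions and an orthogonal
  -- part `w`. The latter is a Kirchhoff step function; its coefficients are those of `u'`, because
  -- those of `a` vanish, and so `w = 0`.
  obtain ⟨a, ha, w, hw, hsum⟩ :=
    (compactDer p ℓ α).topologicalClosure.exists_add_mem_mem_orthogonal u.der
  obtain ⟨c, hc, hK, hwc⟩ := exists_isKirchhoff_of_orthogonal h (w := w)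
    fun g hg => hw g (Submodule.le_topologicalClosure _ hg)
  have ha' := primitive_mem_H10 h ha
  have hw0 : w = 0 := by
    have hc0 := hK.eq_zero_of_inner_eq_zero h hc fun z => by
      have h1 := inner_slopeFn_der_eq_zero h z ⟨primitive_mem_H1t h a, ha'⟩
      have h2 := horth z
      rw [hsum, inner_add_right, hwc] at h2
      rw [der_primitive] at h1
      rwa [h1, zero_add] at h2
    rw [hwc]
    refine Subtype.ext (funext fun e => ?_)
    change Lp.const 2 _ (c e) = 0
    rw [hc0, Pi.zero_apply, map_zero]
  rw [eq_primitive_of_mem_H1t h hu, hsum, hw0, add_zero]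
  exact ha'

/-! ### The expansion in the basis functions -/

/-- The isometry `a ↦ ∑_z a_z φ_z'`. -/
def synthesis (h : Admissible p ℓ α) :
    lp (fun _ : TraceIndex p => ℂ) 2 →ₗᵢ[ℂ] TreeL2 p ℓ α :=
  (orthonormal_slopeFn h).orthogonalFamily.linearIsometry

theorem hasSum_synthesis (h : Admissible p ℓ α) (b : lp (fun _ : TraceIndex p => ℂ) 2) :
    HasSum (fun z => b z • slopeFn h z) (synthesis h b) :=
  (orthonormal_slopeFn h).orthogonalFamily.hasSum_linearIsometry b

/-- The map `g ↦ (⟨φ_z', g⟩)_z`. -/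
def analysis (h : Admissible p ℓ α) :
    TreeL2 p ℓ α →L[ℂ] lp (fun _ : TraceIndex p => ℂ) 2 :=
  ContinuousLinearMap.adjoint (synthesis h).toContinuousLinearMap

theorem inner_analysis_left (h : Admissible p ℓ α) (g : TreeL2 p ℓ α)
    (b : lp (fun _ : TraceIndex p => ℂ) 2) :
    inner ℂ (analysis h g) b = inner ℂ g (synthesis h b) :=
  ContinuousLinearMap.adjoint_inner_left _ _ _

theorem inner_analysis_right (h : Admissible p ℓ α) (g : TreeL2 p ℓ α)
    (b : lp (fun _ : TraceIndex p => ℂ) 2) :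
    inner ℂ b (analysis h g) = inner ℂ (synthesis h b) g :=
  ContinuousLinearMap.adjoint_inner_right _ _ _

theorem analysis_apply (h : Admissible p ℓ α) (g : TreeL2 p ℓ α) (z : TraceIndex p) :
    analysis h g z = inner ℂ (slopeFn h z) g := by
  classical
  have h1 := lp.inner_single_left (𝕜 := ℂ) (G := fun _ : TraceIndex p => ℂ) z 1 (analysis h g)
  have h2 : synthesis h (lp.single 2 z (1 : ℂ)) = slopeFn h z := by
    have := (orthonormal_slopeFn h).orthogonalFamily.linearIsometry_apply_single (i := z) (1 : ℂ)
    exact this.trans (one_smul _ _)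
  rw [inner_analysis_right, h2] at h1
  rw [h1]
  simp

theorem analysis_synthesis (h : Admissible p ℓ α) (b : lp (fun _ : TraceIndex p => ℂ) 2) :
    analysis h (synthesis h b) = b := by
  refine ext_inner_right ℂ fun d => ?_
  rw [inner_analysis_left]
  exact (synthesis h).inner_map_map b d

theorem analysis_der_eq_zero (h : Admissible p ℓ α) {u : H1 p ℓ α} (hu : u ∈ H1t0 p ℓ α) :
    analysis h u.der = 0 := by
  refine lp.ext (funext fun z => ?_)
  rw [analysis_apply, inner_slopeFn_der_eq_zero h z hu]
  rfl

theorem mem_H1t0_of_analysis_eq_zero (h : Admissible p ℓ α) {u : H1 p ℓ α} (hu : u ∈ H1t p ℓ α)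
    (h0 : analysis h u.der = 0) : u ∈ H1t0 p ℓ α := by
  refine ⟨hu, mem_H10_of_inner_eq_zero h hu fun z => ?_⟩
  rw [← analysis_apply, h0]
  rfl

theorem der_sub (u v : H1 p ℓ α) : (u - v).der = u.der - v.der := rfl

/-- The elements `φ z` are quantified existentially in `IsTheta`, but their representatives force
them to be the primitives of the `slopeFn h z`. -/
theorem isTheta_iff (h : Admissible p ℓ α) {b : lp (fun _ : TraceIndex p => ℂ) 2} {u : H1 p ℓ α} :
    IsTheta b u ↔ u ∈ H1t p ℓ α ∧ u.der = synthesis h b := by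
  constructor
  · rintro ⟨hu, φ, hφ, hsum⟩
    refine ⟨hu, hsum.unique ?_⟩
    have h1 : ∀ z, φ z = primitive h (slopeFn h z) := fun z => by
      refine sub_eq_zero.1 (eq_zero_of_fn_eq_zero h ?_)
      change (φ z).fn - (primitive h (slopeFn h z)).fn = 0
      rw [(hφ z).2.fn_eq (represents_basisFun h z), sub_self]
    simpa only [h1, der_primitive] using hasSum_synthesis h b
  · rintro ⟨hu, hder⟩
    refine ⟨hu, fun z => primitive h (slopeFn h z),
      fun z => ⟨primitive_mem_H1t h _, represents_basisFun h z⟩, ?_⟩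
    rw [hder]
    exact hasSum_synthesis h b

/-- On derivatives, synthesis after analysis is the orthogonal projection onto the closed span of
the basis. The remainder has zero coefficients, so by completeness it belongs to `H̃¹₀`. -/
theorem isHarmonicProj_primitive (h : Admissible p ℓ α) {g : H1 p ℓ α} (hg : g ∈ H1t p ℓ α) :
    IsHarmonicProj g (primitive h (synthesis h (analysis h g.der))) := by
  refine ⟨⟨primitive_mem_H1t h _, fun v hv => ?_⟩,
    mem_H1t0_of_analysis_eq_zero h (sub_mem hg (primitive_mem_H1t h _)) ?_⟩
  · rw [der_primitive, ← inner_analysis_left, analysis_der_eq_zero h hv, inner_zero_left]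
  · rw [der_sub, der_primitive, map_sub, analysis_synthesis, sub_self]

/-- Analysis kills `g - h ∈ H̃¹₀`, so the coefficients of any harmonic projection `h` are those of
`g`. This turns the relational definition into an explicit bounded operator. -/
theorem isTrace_iff (h : Admissible p ℓ α) {g : H1 p ℓ α} (hg : g ∈ H1t p ℓ α)
    {a : WeightedL2 p (sigma p ℓ α)} :
    IsTrace g a ↔ ∀ z, a.1 z = (multCoeff ℓ α z : ℂ) * analysis h g.der z := by
  constructor
  · rintro ⟨u, b, ⟨-, hu⟩, hb, ha⟩
    have h1 := ((isTheta_iff h).1 hb).2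
    have h2 := analysis_der_eq_zero h hu
    rw [der_sub, h1, map_sub, analysis_synthesis, sub_eq_zero] at h2
    rwa [h2]
  · intro ha
    exact ⟨_, analysis h g.der, isHarmonicProj_primitive h hg,
      (isTheta_iff h).2 ⟨primitive_mem_H1t h _, rfl⟩, ha⟩

/-! ### The multiplication operator -/

theorem memℓp_two_of_norm_le {ι : Type*} {f g : ι → ℂ} {C : ℝ} (hg : Memℓp g 2)
    (h : ∀ i, ‖f i‖ ≤ C * ‖g i‖) : Memℓp f 2 := by
  have h1 := (hg.summable (by simp)).mul_left (C ^ 2)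
  refine memℓp_gen (Summable.of_nonneg_of_le (fun i => by positivity) (fun i => ?_) h1)
  have h2 := pow_le_pow_left₀ (norm_nonneg _) (h i) 2
  rw [mul_pow] at h2
  simpa using h2

theorem norm_weight_mul (h : Admissible p ℓ α) (z : TraceIndex p) (x : ℂ) :
    ‖(weight (sigma p ℓ α) z : ℂ) * ((multCoeff ℓ α z : ℂ) * x)‖ = weightedCoeff ℓ α z * ‖x‖ := by
  rw [norm_mul, norm_mul, Complex.norm_real, Complex.norm_real,
    Real.norm_of_nonneg (weight_sigma_pos h z).le, Real.norm_of_nonneg (multCoeff_pos h z).le,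
    weightedCoeff, mul_assoc]

theorem multCoeff_mul_mem (h : Admissible p ℓ α) (b : lp (fun _ : TraceIndex p => ℂ) 2) :
    (fun z => (multCoeff ℓ α z : ℂ) * b z) ∈ weightedSeq p (sigma p ℓ α) := by
  obtain ⟨a, B, ha, hB⟩ := exists_weightedCoeff_bounds h
  obtain ⟨w, hw, hw'⟩ := exists_weight_bound h
  have h1 : ∀ z, ‖(weight (sigma p ℓ α) z : ℂ) * ((multCoeff ℓ α z : ℂ) * b z)‖ ≤ B * ‖b z‖ := by
    intro z
    rw [norm_weight_mul h]
    gcongr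
    exact (hB z).2
  have h2 : Memℓp (fun z => (weight (sigma p ℓ α) z : ℂ) * ((multCoeff ℓ α z : ℂ) * b z)) 2 :=
    memℓp_two_of_norm_le (lp.memℓp b) h1
  refine ⟨memℓp_two_of_norm_le (C := w⁻¹) h2 fun z => ?_, h2⟩
  rw [norm_mul (weight _ z : ℂ), Complex.norm_real, Real.norm_of_nonneg (weight_sigma_pos h z).le,
    ← mul_assoc]
  refine le_mul_of_one_le_left (norm_nonneg _) ?_
  rw [inv_mul_eq_div]
  exact (one_le_div hw).2 (hw' z)

theorem exists_multiplier [NeZero p] (h : Admissible p ℓ α) :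
    ∃ M : lp (fun _ : TraceIndex p => ℂ) 2 →L[ℂ] WeightedL2 p (sigma p ℓ α),
      (∀ b z, (M b).1 z = (multCoeff ℓ α z : ℂ) * b z) ∧ Function.Bijective M := by
  obtain ⟨a, B, ha, hB⟩ := exists_weightedCoeff_bounds h
  have hB0 : 0 ≤ B := (ha.le.trans (hB .rad).1).trans (hB .rad).2
  let M₀ : lp (fun _ : TraceIndex p => ℂ) 2 →ₗ[ℂ] WeightedL2 p (sigma p ℓ α) :=
    { toFun := fun b => ⟨fun z => (multCoeff ℓ α z : ℂ) * b z, multCoeff_mul_mem h b⟩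
      map_add' := fun b d => Subtype.ext (funext fun z => mul_add _ _ _)
      map_smul' := fun c b => Subtype.ext (funext fun z => mul_left_comm _ _ _) }
  have hbound : ∀ b, ‖M₀ b‖ ≤ B * ‖b‖ := by
    intro b
    change ‖WeightedL2.toL2 p (sigma p ℓ α) (M₀ b)‖ ≤ B * ‖b‖
    refine norm_le_of_sum_sq_le (by positivity) fun s => ?_
    calc ∑ z ∈ s, ‖WeightedL2.toL2 p (sigma p ℓ α) (M₀ b) z‖ ^ 2
        ≤ ∑ z ∈ s, B ^ 2 * ‖b z‖ ^ 2 := by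
          refine Finset.sum_le_sum fun z _ => ?_
          rw [← mul_pow]
          refine pow_le_pow_left₀ (norm_nonneg _) ?_ 2
          refine (norm_weight_mul h z (b z)).trans_le ?_
          gcongr
          exact (hB z).2
      _ ≤ (B * ‖b‖) ^ 2 := by
          rw [← Finset.mul_sum, mul_pow]
          gcongr
          exact sum_norm_sq_le b s
  have hne : ∀ z : TraceIndex p, (multCoeff ℓ α z : ℂ) ≠ 0 := fun z => by
    exact_mod_cast (multCoeff_pos h z).ne'
  refine ⟨M₀.mkContinuous B hbound, fun b z => rfl, fun b d hbd => ?_, fun d => ?_⟩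
  · refine lp.ext (funext fun z => ?_)
    exact mul_left_cancel₀ (hne z) (congrFun (congrArg Subtype.val hbd) z)
  -- The lower bound `a` on weight times coefficient makes division by the coefficient of `M`
  -- bounded from `ℓ²_σ` to `ℓ²`.
  · have hmem : Memℓp (fun z => d.1 z / (multCoeff ℓ α z : ℂ)) 2 := by
      refine memℓp_two_of_norm_le (C := a⁻¹) d.2.2 fun z => ?_
      have h1 := norm_weight_mul h z (d.1 z / (multCoeff ℓ α z : ℂ))
      rw [mul_div_cancel₀ _ (hne z)] at h1
      rw [h1, ← mul_assoc, inv_mul_eq_div]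
      exact le_mul_of_one_le_left (norm_nonneg _) ((one_le_div ha).2 (hB z).1)
    exact ⟨⟨_, hmem⟩, Subtype.ext (funext fun z => mul_div_cancel₀ _ (hne z))⟩

/-! ### The trace operator. -/

theorem EventuallyAgree.sub_mem {f g : H1 p ℓ α} (hfg : EventuallyAgree f g) :
    f - g ∈ H1c p ℓ α := by
  obtain ⟨n, hn⟩ := hfg
  refine ⟨n, fun e he => ?_⟩
  change f.fn e - g.fn e = 0
  rw [hn e he, sub_self]

theorem eventuallyAgree_sub {f u : H1 p ℓ α} (hu : u ∈ H1c p ℓ α) : EventuallyAgree f (f - u) := by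
  obtain ⟨n, hn⟩ := hu
  refine ⟨n, fun e he => ?_⟩
  change f.fn e = f.fn e - u.fn e
  rw [hn e he, sub_zero]

end GeomTree

end

-- The equivalence `IsTrace g a ↔ τ f = a` expresses at once that the trace of `g` exists in `ℓ²_σ`,
-- is unique, and is the same for every admissible `g`.
open GeomTree in
theorem theorem2p8 (p : ℕ) [NeZero p] (ℓ α : ℝ) (hp : 2 ≤ p) (hℓ0 : 0 < ℓ) (hℓ1 : ℓ < 1)
    (hα : 0 < α) (h1 : ℓ < α * p) (h2 : α * p < 1 / ℓ) :
    (∀ f : H1 p ℓ α, ∃ g ∈ H1t p ℓ α, EventuallyAgree f g) ∧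
    ∃ τ : H1 p ℓ α →L[ℂ] WeightedL2 p (sigma p ℓ α),
      (∀ f : H1 p ℓ α, ∀ g ∈ H1t p ℓ α, EventuallyAgree f g →
        ∀ a, IsTrace g a ↔ τ f = a) ∧
      Function.Surjective τ ∧
      LinearMap.ker (τ : H1 p ℓ α →ₗ[ℂ] WeightedL2 p (sigma p ℓ α)) = H10 p ℓ α := by
  have h : Admissible p ℓ α := ⟨hp, hℓ0, hℓ1, hα, h1, (lt_div_iff₀ hℓ0).1 h2⟩
  obtain ⟨χ, hχ, hχ1⟩ := exists_cutoff h
  obtain ⟨M, hM, hMbij⟩ := exists_multiplier h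
  -- Subtracting `f(o) χ` removes the value at the root and changes `f` only by an element of `H1c`,
  -- linearly and continuously in `f`.
  let R : H1 p ℓ α →L[ℂ] H1 p ℓ α :=
    ContinuousLinearMap.id ℂ _ - (evalRoot h).smulRight χ
  have hR : ∀ f, R f = f - evalRoot h f • χ := fun f => rfl
  have hRt : ∀ f, R f ∈ H1t p ℓ α := fun f => by
    rw [mem_H1t_iff h, hR, map_sub, map_smul, hχ1, smul_eq_mul, mul_one, sub_self]
  have hRc : ∀ f, f - R f ∈ H1c p ℓ α := fun f => by
    rw [hR, sub_sub_cancel]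
    exact Submodule.smul_mem _ _ hχ
  refine ⟨fun f => ⟨R f, hRt f, eventuallyAgree_sub (Submodule.smul_mem _ _ hχ)⟩,
    M ∘L analysis h ∘L derL p ℓ α ∘L R, fun f g hg hfg a => ?_, fun a => ?_, ?_⟩
  -- Both `R f` and `g` differ from `f` by elements of `H1c` and vanish at the root, so they have
  -- the same coefficients.
  · have hmem : R f - g ∈ H1t0 p ℓ α := by
      refine ⟨sub_mem (hRt f) hg, ?_⟩
      have h3 := sub_mem (H1c_le_H10 hfg.sub_mem) (H1c_le_H10 (hRc f))
      rwa [sub_sub_sub_cancel_left] at h3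
    have h4 := analysis_der_eq_zero h hmem
    rw [der_sub, map_sub, sub_eq_zero] at h4
    rw [isTrace_iff h hg, ← h4]
    constructor
    · intro ha
      refine Subtype.ext (funext fun z => ?_)
      rw [ha z]
      exact hM _ z
    · rintro rfl z
      exact hM _ z
  · obtain ⟨b, rfl⟩ := hMbij.2 a
    refine ⟨primitive h (synthesis h b), ?_⟩
    have h3 : R (primitive h (synthesis h b)) = primitive h (synthesis h b) := by
      rw [hR, evalRoot_primitive, zero_smul, sub_zero]
    simp only [ContinuousLinearMap.comp_apply, h3, derL_apply, der_primitive, analysis_synthesis]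
  · ext f
    have h3 : f ∈ LinearMap.ker ((M ∘L analysis h ∘L derL p ℓ α ∘L R).toLinearMap) ↔
        analysis h (R f).der = 0 := by
      rw [LinearMap.mem_ker]
      exact map_eq_zero_iff M hMbij.1
    -- As `f - R f` lies in `H1c`, membership in `H10` is the same for `f` and `R f`.
    refine h3.trans ⟨fun h0 => ?_, fun hf => analysis_der_eq_zero h ⟨hRt f, ?_⟩⟩
    · have h4 := (mem_H1t0_of_analysis_eq_zero h (hRt f) h0).2
      simpa using add_mem h4 (H1c_le_H10 (hRc f))
    · simpa using sub_mem hf (H1c_le_H10 (hRc f))
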